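/- Let $\mathbb E$ be a finite-dimensional real inner product space with induced norm $\|\cdot\|$; product spaces carry the Euclidean product norm. Let $X\subset\mathbb E$ be closed and convex with nonempty interior, and let $F:\mathbb E\to\mathbb E$ be continuously differentiable. Let $f:\operatorname{int}X\to\mathbb R$ be a $\vartheta$-self-concordant barrier for $X$: $f$ is three times continuously differentiable, tends to $+\infty$ at every boundary point of $X$, satisfies $|D^3f(x)[h,h,h]|\le 2\,(D^2f(x)[h,h])^{3/2}$ for all $x\in\operatorname{int}X$, $h\in\mathbb E$, and $$\vartheta=\inf\{t\ge 0:\ t\langle h,\nabla^2f(x)h\rangle-\langle\nabla f(x),h\rangle^2\ge 0\ \ \forall x\in\operatorname{int}X,\ h\in\mathbb E\}<\infty .$$ For $\mu>0$ let $p_\mu(z)\in\operatorname{int}X$ be the solution of $p_\mu(z)+\mu^2\nabla f(p_\mu(z))=z$, and let $p_0(z)=\Pi_X(z)$ be the Euclidean projection of $z$ onto $X$. For $w=(x,y)\in\mathbb E\times\mathbb E$ put $$H_\mu(w)=\bigl(x-p_\mu(x-y),\ F(x)-y\bigr),\qquad \Psi_\mu(w)=\|F(x)-y\|+\|x-p_\mu(x-y)\|,$$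 and $\mathcal N(\beta,\mu)=\{w:\Psi_\mu(w)\le\beta\mu\}$. **Algorithm.** Given are $\sigma,\alpha_1,\alpha_2,\alpha_3\in(0,1)$ and sequences $(\theta_1^{(k)}),(\theta_2^{(k)})\subset(0,1)$ with $\sigma+\sqrt2\,\sup_k\theta_1^{(k)}<1$. * Step 0: choose $\mu_0>0$, $\beta>\sqrt\vartheta$ and $w^{(0)}\in\mathcal N(\beta,\mu_0)$; set $k=0$. * Step 1: if $H_0(w^{(k)})=0$, terminate. Otherwise, if $\Psi_{\mu_k}(w^{(k)})=0$, set $\tilde w^{(k+1)}=w^{(k)}$ and go to Step 3; else let $\Delta\tilde w^{(k)}$ solve $-H_{\mu_k}(w^{(k)})+r_1^{(k)}=DH_{\mu_k}(w^{(k)})[\Delta\tilde w^{(k)}]$, where $\|r_1^{(k)}\|\le\theta_1^{(k)}\|H_{\mu_k}(w^{(k)})\|$. * Step 2: let $\lambda_k$ be the largest $\lambda\in\{1,\alpha_1,\alpha_1^2,\dots\}$ with $\Psi_{\mu_k}(w^{(k)}+\lambda\Delta\tilde w^{(k)})\le(1-\sigma\lambda)\Psi_{\mu_k}(w^{(k)})$;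 set $\tilde w^{(k+1)}=w^{(k)}+\lambda_k\Delta\tilde w^{(k)}$. * Step 3: let $\gamma_k$ be the largest $\gamma\in\{1,\alpha_2,\alpha_2^2,\dots\}$ with $\tilde w^{(k+1)}\in\mathcal N(\beta,(1-\gamma)\mu_k)$; set $\tilde\mu_{k+1}=(1-\gamma_k)\mu_k$. * Step 4 (approximate Newton step): let $\Delta\hat w^{(k)}$ solve $-H_0(w^{(k)})+r_2^{(k)}=DH_{\mu_k}(w^{(k)})[\Delta\hat w^{(k)}]$, where $\|r_2^{(k)}\|\le\theta_2^{(k)}\|H_0(w^{(k)})\|$; set $\hat w^{(k+1)}=w^{(k)}+\Delta\hat w^{(k)}$. * Step 5: if $\hat w^{(k+1)}\notin\mathcal N(\beta,\tilde\mu_{k+1})$, set $\mu_{k+1}=\tilde\mu_{k+1}$, $w^{(k+1)}=\tilde w^{(k+1)}$. Else, if $H_0(\hat w^{(k+1)})=0$, terminate; otherwise let $\eta_k$ be the largest $\eta\in\{1,\alpha_3,\alpha_3^2,\dots\}$ with $\hat w^{(k+1)}\notin\mathcal N(\beta,\eta\alpha_3\tilde\mu_{k+1})$ and set $\mu_{k+1}=\eta_k\tilde\mu_{k+1}$,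 $w^{(k+1)}=\hat w^{(k+1)}$. Increase $k$ by one and return to Step 1. **Theorem.** Suppose that the algorithm never terminates, producing an infinite sequence $w^{(k)}=(x^{(k)},y^{(k)})$, and that 1. $DH_{\mu_k}(w^{(k)})$ is nonsingular for all $k$ and $\sup_k\|DH_{\mu_k}(w^{(k)})^{-1}\|<\infty$; 2. for every $x\in\mathbb E$, $\|F(y)-F(x)-DF(x)[y-x]\|=o(\|y-x\|)$ as $y\to x$. Let $w^*=(x^*,y^*)$ be a limit point of $(w^{(k)})$, let $z^*=x^*-y^*$, and suppose that $Dp_\mu(z)$ converges to a linear operator $T^*$ as $(z,\mu)\to(z^*,0)$, $\mu>0$, and that $\|r_2^{(k)}\|=o(\|H_0(w^{(k)})\|)$ as $k\to\infty$. Then $w^{(k)}\to w^*$ superlinearly, i.e. $w^{(k)}\to w^*$ and $\|w^{(k+1)}-w^*\|=o(\|w^{(k)}-w^*\|)$, and for all sufficiently large $k$ the approximate Newton step is taken in Step 5, i.e. $\hat w^{(k+1)}\in\mathcal N(\beta,\tilde\mu_{k+1})$ and $w^{(k+1)}=\hat w^{(k+1)}$. If, in addition, for some $\xi>1$, 3.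 there is $L>0$ with $\|F(y)-F(x)-DF(x)[y-x]\|\le L\|y-x\|^{\xi}$ for all $x,y\in\mathbb E$, and $\|Dp_\mu(z)-T^*\|=O(\|(z-z^*,\mu)\|^{\xi-1})$ as $(z,\mu)\to(z^*,0)$, $\mu>0$, and $\|r_2^{(k)}\|=O(\|H_0(w^{(k)})\|^{\xi})$ as $k\to\infty$, then the convergence is of order $\xi$: $\|w^{(k+1)}-w^*\|=O(\|w^{(k)}-w^*\|^{\xi})$. -/

import Mathlib

open Filter Topology Asymptotics

noncomputable section

namespace NonInterior

variable {E : Type*} [NormedAddCommGroup E] [InnerProductSpace ℝ E]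

/-- `f` (only its values on the interior of `X` matter) is a barrier of `X`: it tends to `+∞`
along the interior of `X` at every boundary point of `X`. -/
def IsBarrier (X : Set E) (f : E → ℝ) : Prop :=
  ∀ x ∈ frontier X, Tendsto f (𝓝[interior X] x) atTop

/-- The numbers `t ≥ 0` with `t ⟨h, ∇²f(x) h⟩ - ⟨∇f(x), h⟩² ≥ 0` for all `x ∈ int X` and all `h`. -/
def barrierParameterSet (X : Set E) (f : E → ℝ) : Set ℝ :=
  {t | 0 ≤ t ∧ ∀ x ∈ interior X, ∀ h : E,
    0 ≤ t * iteratedFDeriv ℝ 2 f x (fun _ => h) - (fderiv ℝ f x h) ^ 2}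

/-- `f` is a `ϑ`-self-concordant barrier for `X`. The barrier parameter `ϑ` is the infimum of
`barrierParameterSet X f`; it is finite, i.e. that set is nonempty. -/
structure IsSelfConcordantBarrier (X : Set E) (f : E → ℝ) (ϑ : ℝ) : Prop where
  contDiffOn : ContDiffOn ℝ 3 f (interior X)
  isBarrier : IsBarrier X f
  parameter_finite : (barrierParameterSet X f).Nonempty
  parameter_eq : ϑ = sInf (barrierParameterSet X f)
  third_deriv_le : ∀ x ∈ interior X, ∀ h : E,
    |iteratedFDeriv ℝ 3 f x (fun _ => h)| ≤
      2 * (iteratedFDeriv ℝ 2 f x (fun _ => h)) ^ (3 / 2 : ℝ)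

/-- The Euclidean projection of `z` onto `X`: the minimizer of the distance to `z` over `X`
(it exists and is unique when `X` is nonempty, closed and convex). -/
def proj (X : Set E) (z : E) : E :=
  Classical.epsilon fun q => q ∈ X ∧ ∀ x ∈ X, ‖q - z‖ ≤ ‖x - z‖

/-- The barrier-based smoothing approximation `p_μ(z)` of the projection onto `X`: the solution
`q ∈ int X` of `q + μ² ∇f(q) = z` when `μ ≠ 0`, and the projection of `z` when `μ = 0`.
It is only ever used with `μ ≥ 0`. -/
def smoothing [CompleteSpace E] (X : Set E) (f : E → ℝ) (μ : ℝ) (z : E) : E :=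
  open Classical in
  if μ = 0 then proj X z
  else Classical.epsilon fun q => q ∈ interior X ∧ q + μ ^ 2 • gradient f q = z

/-- `φ_μ(x, y) = x - p_μ(x - y)`. The space `E × E` carries the Euclidean product norm. -/
def phi [CompleteSpace E] (X : Set E) (f : E → ℝ) (μ : ℝ) (w : WithLp 2 (E × E)) : E :=
  w.fst - smoothing X f μ (w.fst - w.snd)

/-- The smoothed natural map `H_μ(x, y) = (x - p_μ(x - y), F(x) - y)`. -/
def natMap [CompleteSpace E] (X : Set E) (f : E → ℝ) (F : E → E) (μ : ℝ)
    (w : WithLp 2 (E × E)) : WithLp 2 (E × E) :=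
  WithLp.toLp 2 (phi X f μ w, F w.fst - w.snd)

/-- The merit function `Ψ_μ(x, y) = ‖F(x) - y‖ + ‖φ_μ(x, y)‖`. -/
def merit [CompleteSpace E] (X : Set E) (f : E → ℝ) (F : E → E) (μ : ℝ)
    (w : WithLp 2 (E × E)) : ℝ :=
  ‖F w.fst - w.snd‖ + ‖phi X f μ w‖

/-- The neighbourhood `𝒩(β, μ) = {w | Ψ_μ(w) ≤ β μ}`. -/
def nbhd [CompleteSpace E] (X : Set E) (f : E → ℝ) (F : E → E) (β μ : ℝ) :
    Set (WithLp 2 (E × E)) :=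
  {w | merit X f F μ w ≤ β * μ}

/-- The parameters of the inexact non-interior continuation method. -/
structure Params where
  σ : ℝ
  α₁ : ℝ
  α₂ : ℝ
  α₃ : ℝ
  β : ℝ
  θ₁ : ℕ → ℝ
  θ₂ : ℕ → ℝ

/-- The requirements on the parameters; `ϑ` is the barrier parameter. -/
structure Params.Valid (P : Params) (ϑ : ℝ) : Prop where
  σ_mem : P.σ ∈ Set.Ioo (0 : ℝ) 1
  α₁_mem : P.α₁ ∈ Set.Ioo (0 : ℝ) 1
  α₂_mem : P.α₂ ∈ Set.Ioo (0 : ℝ) 1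
  α₃_mem : P.α₃ ∈ Set.Ioo (0 : ℝ) 1
  θ₁_mem : ∀ k, P.θ₁ k ∈ Set.Ioo (0 : ℝ) 1
  θ₂_mem : ∀ k, P.θ₂ k ∈ Set.Ioo (0 : ℝ) 1
  θ₁_sup : P.σ + √2 * (⨆ k, P.θ₁ k) < 1
  β_gt : √ϑ < P.β

/-- The quantities computed by the method. `wTilde (k + 1)`, `muTilde (k + 1)` and `wHat (k + 1)`
are computed in iteration `k` (their values at index `0` play no role); `lam`, `gam`, `eta` are the
step lengths `λ_k`, `γ_k`, `η_k`; `r₁`, `r₂` are the residuals of the two inexact Newton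
equations. -/
structure Iterates (E : Type*) where
  w : ℕ → WithLp 2 (E × E)
  wTilde : ℕ → WithLp 2 (E × E)
  wHat : ℕ → WithLp 2 (E × E)
  dTilde : ℕ → WithLp 2 (E × E)
  dHat : ℕ → WithLp 2 (E × E)
  r₁ : ℕ → WithLp 2 (E × E)
  r₂ : ℕ → WithLp 2 (E × E)
  mu : ℕ → ℝ
  muTilde : ℕ → ℝ
  lam : ℕ → ℝ
  gam : ℕ → ℝ
  eta : ℕ → ℝ

/-- `I` is an infinite (never terminating) run of the inexact non-interior continuation method for
`VI(X, F)` with the barrier `f` and the parameters `P`. -/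
structure IsInfiniteRun [CompleteSpace E] (X : Set E) (f : E → ℝ) (F : E → E)
    (P : Params) (I : Iterates E) : Prop where
  /-- Step 0: initialization. -/
  mu_zero_pos : 0 < I.mu 0
  w_zero_mem : I.w 0 ∈ nbhd X f F P.β (I.mu 0)
  /-- Step 1: no termination. -/
  not_solved : ∀ k, natMap X f F 0 (I.w k) ≠ 0
  /-- Step 1: if `Ψ_{μ_k}(w_k) = 0`, the centering step is trivial and Step 2 is skipped. -/
  centering_trivial : ∀ k, merit X f F (I.mu k) (I.w k) = 0 → I.wTilde (k + 1) = I.w k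
  /-- Step 1: otherwise, an inexact Newton direction for `H_{μ_k}`. -/
  centering_newton : ∀ k, merit X f F (I.mu k) (I.w k) ≠ 0 →
    -natMap X f F (I.mu k) (I.w k) + I.r₁ k =
      fderiv ℝ (natMap X f F (I.mu k)) (I.w k) (I.dTilde k)
  centering_residual : ∀ k, merit X f F (I.mu k) (I.w k) ≠ 0 →
    ‖I.r₁ k‖ ≤ P.θ₁ k * ‖natMap X f F (I.mu k) (I.w k)‖
  /-- Step 2: line search for the centering step. -/
  line_search : ∀ k, merit X f F (I.mu k) (I.w k) ≠ 0 →
    IsGreatest {t : ℝ | (∃ j : ℕ, t = P.α₁ ^ j) ∧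
      merit X f F (I.mu k) (I.w k + t • I.dTilde k) ≤
        (1 - P.σ * t) * merit X f F (I.mu k) (I.w k)} (I.lam k)
  wTilde_eq : ∀ k, merit X f F (I.mu k) (I.w k) ≠ 0 →
    I.wTilde (k + 1) = I.w k + I.lam k • I.dTilde k
  /-- Step 3: reduction of `μ` based on the centering step. -/
  gam_greatest : ∀ k, IsGreatest {t : ℝ | (∃ j : ℕ, t = P.α₂ ^ j) ∧
    I.wTilde (k + 1) ∈ nbhd X f F P.β ((1 - t) * I.mu k)} (I.gam k)
  muTilde_eq : ∀ k, I.muTilde (k + 1) = (1 - I.gam k) * I.mu k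
  /-- Step 4: the approximate Newton step. -/
  newton : ∀ k, -natMap X f F 0 (I.w k) + I.r₂ k =
    fderiv ℝ (natMap X f F (I.mu k)) (I.w k) (I.dHat k)
  newton_residual : ∀ k, ‖I.r₂ k‖ ≤ P.θ₂ k * ‖natMap X f F 0 (I.w k)‖
  wHat_eq : ∀ k, I.wHat (k + 1) = I.w k + I.dHat k
  /-- Step 5: if the approximate Newton step leaves the neighbourhood, it is rejected and the
  centering step is taken. -/
  rejected : ∀ k, I.wHat (k + 1) ∉ nbhd X f F P.β (I.muTilde (k + 1)) →
    I.mu (k + 1) = I.muTilde (k + 1) ∧ I.w (k + 1) = I.wTilde (k + 1)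
  /-- Step 5: otherwise (again without termination) it is taken and `μ` is reduced further. -/
  accepted : ∀ k, I.wHat (k + 1) ∈ nbhd X f F P.β (I.muTilde (k + 1)) →
    natMap X f F 0 (I.wHat (k + 1)) ≠ 0 ∧
    IsGreatest {t : ℝ | (∃ j : ℕ, t = P.α₃ ^ j) ∧
      I.wHat (k + 1) ∉ nbhd X f F P.β (t * P.α₃ * I.muTilde (k + 1))} (I.eta k) ∧
    I.mu (k + 1) = I.eta k * I.muTilde (k + 1) ∧ I.w (k + 1) = I.wHat (k + 1)

/-- Along the run, `D H_{μ_k}(w_k)` is nonsingular with uniformly bounded inverse. -/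
def UniformlyNonsingular [CompleteSpace E] (X : Set E) (f : E → ℝ) (F : E → E)
    (I : Iterates E) : Prop :=
  ∃ C : ℝ, ∀ k,
    (fderiv ℝ (natMap X f F (I.mu k)) (I.w k)).IsInvertible ∧
    ‖(fderiv ℝ (natMap X f F (I.mu k)) (I.w k)).inverse‖ ≤ C

/-- `‖F(y) - F(x) - DF(x)[y - x]‖ = o(‖y - x‖)` as `y → x`, for every `x`. -/
def LinearizationLittleO (F : E → E) : Prop :=
  ∀ x, (fun y => F y - F x - fderiv ℝ F x (y - x)) =o[𝓝 x] (fun y => y - x)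

/-- `‖F(y) - F(x) - DF(x)[y - x]‖ ≤ L ‖y - x‖ ^ ξ` for all `x`, `y`, with some `L > 0`. -/
def LinearizationOrder (F : E → E) (ξ : ℝ) : Prop :=
  ∃ L : ℝ, 0 < L ∧ ∀ x y, ‖F y - F x - fderiv ℝ F x (y - x)‖ ≤ L * ‖y - x‖ ^ ξ

end NonInterior

end

/-! The barrier parameter gives `⟨∇f(x), y - x⟩ ≤ ϑ` for `x ∈ int X`, `y ∈ X`, whence `‖p_μ(z) -
p_ν(z)‖² ≤ ϑ (μ² - ν²)` for `0 ≤ ν ≤ μ`. So `Ψ_μ` and `Ψ_0` differ by at most `√ϑ μ`, and `β > √ϑ`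
leaves slack in the neighbourhoods.

Global part (`tendsto_mu`): the `μ_k` decrease. Were their limit positive, the maps `H_{μ_k}` would
be uniformly linearizable near `w*`; at iterates close to `w*` the centering step would then reduce
the merit by a fixed fraction, and `μ` would shrink by a fixed factor infinitely often, which is
absurd. Hence `μ_k → 0`, and `Ψ_{μ_k}(w_k) ≤ β μ_k` forces `H_0(w*) = 0`.

Local part: convergence of `Dp_μ` makes `H_0` strictly differentiable at `w*`, with derivative `A`
the limit of `DH_μ(w)`. With `v = w_k - w*` and `D = DH_{μ_k}(w_k)`, the Newton equation reads `D (ŵ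
- w*) = (D - A) v - (H_0(w_k) - A v) + r₂`, whose right side is `o(‖v‖)`; the bounded inverses turn
this into a contraction (`exists_ball_norm_wHat_sub_le`). The contraction also gives `‖v‖ = O(μ_k)`,
so `Ψ_0(ŵ)` is small compared with `μ_k` and the step is accepted (`exists_ball_wHat_mem_nbhd`). One
iterate close enough to `w*` is then trapped (`tendsto_w`).

For order `ξ`, the lower bound on the merit built into the choice of `η_k` gives `μ_k = O(‖v‖)`
(`exists_eventually_mu_le`), so each term on the right becomes `O(‖v‖ ^ ξ)`. -/

namespace NonInterior

/-! ### Convexity and gradient bounds of self-concordant barriers. -/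

section Barrier

variable {E : Type*} [NormedAddCommGroup E] [InnerProductSpace ℝ E]
  {X : Set E} {f : E → ℝ} {ϑ : ℝ}

/-- Closedness means that the infimum `ϑ` is attained, so the defining inequality holds with `t =
ϑ`. -/
lemma isClosed_barrierParameterSet (X : Set E) (f : E → ℝ) :
    IsClosed (barrierParameterSet X f) := by
  have : barrierParameterSet X f = Set.Ici 0 ∩ ⋂ x ∈ interior X, ⋂ h : E,
      {t : ℝ | 0 ≤ t * iteratedFDeriv ℝ 2 f x (fun _ => h) - (fderiv ℝ f x h) ^ 2} := by
    ext t
    simp [barrierParameterSet]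
  rw [this]
  refine isClosed_Ici.inter (isClosed_biInter fun x _ => isClosed_iInter fun h => ?_)
  exact isClosed_le continuous_const (by fun_prop)

namespace IsSelfConcordantBarrier

variable (hf : IsSelfConcordantBarrier X f ϑ)

include hf

lemma parameter_mem : ϑ ∈ barrierParameterSet X f := by
  rw [hf.parameter_eq]
  exact (isClosed_barrierParameterSet X f).csInf_mem hf.parameter_finite ⟨0, fun _ ht => ht.1⟩

lemma parameter_nonneg : 0 ≤ ϑ := hf.parameter_mem.1

lemma sq_fderiv_le {x : E} (hx : x ∈ interior X) (h : E) :
    (fderiv ℝ f x h) ^ 2 ≤ ϑ * fderiv ℝ (fderiv ℝ f) x h h := by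
  have := hf.parameter_mem.2 x hx h
  rw [iteratedFDeriv_two_apply] at this
  linarith

lemma contDiffOn_fderiv : ContDiffOn ℝ 2 (fderiv ℝ f) (interior X) :=
  hf.contDiffOn.fderiv_of_isOpen isOpen_interior (by norm_num)

lemma hasFDerivAt {x : E} (hx : x ∈ interior X) : HasFDerivAt f (fderiv ℝ f x) x :=
  ((hf.contDiffOn.contDiffAt (isOpen_interior.mem_nhds hx)).differentiableAt
    (by norm_num)).hasFDerivAt

lemma hasFDerivAt_fderiv {x : E} (hx : x ∈ interior X) :
    HasFDerivAt (fderiv ℝ f) (fderiv ℝ (fderiv ℝ f) x) x :=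
  ((hf.contDiffOn_fderiv.contDiffAt (isOpen_interior.mem_nhds hx)).differentiableAt
    (by norm_num)).hasFDerivAt

/-- Convexity of `f` is not assumed but extracted from `⟨∇f, h⟩² ≤ ϑ D²f[h, h]`. For `ϑ = 0` this
inequality gives no sign, but it makes the gradient vanish on the interior, and the Hessian with it.
-/
lemma hessian_nonneg {x : E} (hx : x ∈ interior X) (h : E) :
    0 ≤ fderiv ℝ (fderiv ℝ f) x h h := by
  rcases hf.parameter_nonneg.eq_or_lt with h0 | h0
  · have hz : ∀ᶠ y in 𝓝 x, fderiv ℝ f y = (fun _ => 0 : E → E →L[ℝ] ℝ) y := by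
      filter_upwards [isOpen_interior.mem_nhds hx] with y hy
      ext k
      have := hf.sq_fderiv_le hy k
      rw [← h0, zero_mul] at this
      simpa using le_antisymm this (sq_nonneg _)
    rw [Filter.EventuallyEq.fderiv_eq hz]
    simp
  · have := (sq_nonneg _).trans (hf.sq_fderiv_le hx h)
    exact nonneg_of_mul_nonneg_right this h0

lemma hasDerivAt_fderiv_segment {x h : E} {s : ℝ} (hs : x + s • h ∈ interior X) :
    HasDerivAt (fun s : ℝ => fderiv ℝ f (x + s • h) h)
      (fderiv ℝ (fderiv ℝ f) (x + s • h) h h) s := by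
  have h1 : HasDerivAt (fun s : ℝ => x + s • h) h s := by
    simpa using ((hasDerivAt_id s).smul_const h).const_add x
  have h2 := (hf.hasFDerivAt_fderiv hs).comp_hasDerivAt s h1
  exact ((ContinuousLinearMap.apply ℝ ℝ h).hasFDerivAt.comp_hasDerivAt s h2)

lemma hasDerivAt_segment {x h : E} {s : ℝ} (hs : x + s • h ∈ interior X) :
    HasDerivAt (fun s : ℝ => f (x + s • h)) (fderiv ℝ f (x + s • h) h) s := by
  have h1 : HasDerivAt (fun s : ℝ => x + s • h) h s := by
    simpa using ((hasDerivAt_id s).smul_const h).const_add x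
  exact (hf.hasFDerivAt hs).comp_hasDerivAt s h1

variable (hX : Convex ℝ X)
include hX

omit hf in
lemma segment_mem {x y : E} (hx : x ∈ interior X) (hy : y ∈ interior X) {s : ℝ}
    (hs : s ∈ Set.Icc (0 : ℝ) 1) : x + s • (y - x) ∈ interior X :=
  hX.interior.add_smul_sub_mem hx hy hs

lemma monotoneOn_fderiv_segment {x y : E} (hx : x ∈ interior X) (hy : y ∈ interior X) :
    MonotoneOn (fun s : ℝ => fderiv ℝ f (x + s • (y - x)) (y - x)) (Set.Icc 0 1) := by
  have hd : ∀ s ∈ Set.Icc (0 : ℝ) 1, HasDerivAt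
      (fun s : ℝ => fderiv ℝ f (x + s • (y - x)) (y - x))
      (fderiv ℝ (fderiv ℝ f) (x + s • (y - x)) (y - x) (y - x)) s :=
    fun s hs => hf.hasDerivAt_fderiv_segment (segment_mem hX hx hy hs)
  refine monotoneOn_of_hasDerivWithinAt_nonneg (convex_Icc 0 1)
    (fun s hs => (hd s hs).continuousAt.continuousWithinAt)
    (fun s hs => (hd s (interior_subset hs)).hasDerivWithinAt) fun s hs => ?_
  exact hf.hessian_nonneg (segment_mem hX hx hy (interior_subset hs)) _

lemma fderiv_mono {x y : E} (hx : x ∈ interior X) (hy : y ∈ interior X) :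
    fderiv ℝ f x (y - x) ≤ fderiv ℝ f y (y - x) := by
  simpa using hf.monotoneOn_fderiv_segment hX hx hy (Set.left_mem_Icc.2 zero_le_one)
    (Set.right_mem_Icc.2 zero_le_one) zero_le_one

lemma add_fderiv_le {x y : E} (hx : x ∈ interior X) (hy : y ∈ interior X) :
    f x + fderiv ℝ f x (y - x) ≤ f y := by
  obtain ⟨c, hc, he⟩ := exists_hasDerivAt_eq_slope (fun s : ℝ => f (x + s • (y - x)))
    (fun s => fderiv ℝ f (x + s • (y - x)) (y - x)) zero_lt_one
    (fun s hs => (hf.hasDerivAt_segment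
      (segment_mem hX hx hy hs)).continuousAt.continuousWithinAt)
    (fun s hs => hf.hasDerivAt_segment (segment_mem hX hx hy (Set.Ioo_subset_Icc_self hs)))
  have := hf.monotoneOn_fderiv_segment hX hx hy (Set.left_mem_Icc.2 zero_le_one)
    (Set.Ioo_subset_Icc_self hc) hc.1.le
  simp only [zero_smul, add_zero, one_smul, add_sub_cancel, sub_zero, div_one] at he this
  linarith

/-- Along the segment, `φ(s) = ⟨∇f(x + s(y - x)), y - x⟩` satisfies `φ² ≤ ϑ φ'`. A solution starting
above `ϑ` would blow up before `s = 1`. -/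
lemma fderiv_sub_le_of_mem_interior {x y : E} (hx : x ∈ interior X) (hy : y ∈ interior X) :
    fderiv ℝ f x (y - x) ≤ ϑ := by
  by_contra! hlt
  set φ : ℝ → ℝ := fun s => fderiv ℝ f (x + s • (y - x)) (y - x) with hφ
  have hϑ := hf.parameter_nonneg
  have h0 : φ 0 = fderiv ℝ f x (y - x) := by simp [hφ]
  have hpos : ∀ s ∈ Set.Icc (0 : ℝ) 1, 0 < φ s := fun s hs => by
    have := hf.monotoneOn_fderiv_segment hX hx hy (Set.left_mem_Icc.2 zero_le_one) hs hs.1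
    change φ 0 ≤ φ s at this
    linarith
  -- The differential inequality says that `-ϑ/φ(s) - s` is nondecreasing. Comparing `s = 0` and `s
  -- = 1` gives `1 + ϑ/φ(1) ≤ ϑ/φ(0) < 1`.
  have hd : ∀ s ∈ Set.Icc (0 : ℝ) 1, HasDerivAt (fun s => -(ϑ * (φ s)⁻¹) - s)
      (-(ϑ * (-(fderiv ℝ (fderiv ℝ f) (x + s • (y - x)) (y - x) (y - x)) / (φ s) ^ 2)) - 1) s :=
    fun s hs => (((hf.hasDerivAt_fderiv_segment (segment_mem hX hx hy hs)).inv
      (hpos s hs).ne').const_mul ϑ).neg.sub (hasDerivAt_id s)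
  have hm := monotoneOn_of_hasDerivWithinAt_nonneg (convex_Icc (0 : ℝ) 1)
    (fun s hs => (hd s hs).continuousAt.continuousWithinAt)
    (fun s hs => (hd s (interior_subset hs)).hasDerivWithinAt) (fun s hs => by
      have hs' := interior_subset hs
      have h1 := hf.sq_fderiv_le (segment_mem hX hx hy hs') (y - x)
      change (φ s) ^ 2 ≤ _ at h1
      have h2 : 0 < (φ s) ^ 2 := pow_pos (hpos s hs') 2
      rw [neg_div, mul_neg, neg_neg, sub_nonneg, ← mul_div_assoc, le_div_iff₀ h2]
      linarith)
  have h1 := hm (Set.left_mem_Icc.2 zero_le_one) (Set.right_mem_Icc.2 zero_le_one) zero_le_one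
  have h2 : 0 ≤ ϑ * (φ 1)⁻¹ :=
    mul_nonneg hϑ (inv_nonneg.2 (hpos 1 (Set.right_mem_Icc.2 zero_le_one)).le)
  have h3 : 0 < φ 0 := hpos 0 (Set.left_mem_Icc.2 zero_le_one)
  have h4 : ϑ * (φ 0)⁻¹ < 1 := by
    rw [← div_eq_mul_inv, div_lt_one h3]
    linarith
  simp only at h1
  linarith

lemma fderiv_sub_le (hXc : IsClosed X) {x y : E} (hx : x ∈ interior X) (hy : y ∈ X) :
    fderiv ℝ f x (y - x) ≤ ϑ := by
  have hcl : closure (interior X) = X := by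
    rw [hX.closure_interior_eq_closure_of_nonempty_interior ⟨x, hx⟩, hXc.closure_eq]
  have hsub : closure (interior X) ⊆ {y | fderiv ℝ f x (y - x) ≤ ϑ} :=
    closure_minimal (fun y hy => hf.fderiv_sub_le_of_mem_interior hX hx hy)
      (isClosed_le (by fun_prop) continuous_const)
  exact hsub (hcl.symm ▸ hy)

/-- The equation is the stationarity condition of `‖q - z‖²/2 + μ² f(q)`. A minimizer exists because
its sublevel set in the interior is compact: closed, since `f` blows up at the boundary, and
bounded, since `f` has an affine minorant. -/
lemma exists_add_smul_gradient_eq [FiniteDimensional ℝ E] [CompleteSpace E] (hXc : IsClosed X)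
    (hXi : (interior X).Nonempty) {μ : ℝ} (hμ : μ ≠ 0) (z : E) :
    ∃ q ∈ interior X, q + μ ^ 2 • gradient f q = z := by
  obtain ⟨x₀, hx₀⟩ := hXi
  have hμ2 : 0 < μ ^ 2 := by positivity
  set g : E → ℝ := fun q => ‖q - z‖ ^ 2 / 2 + μ ^ 2 * f q with hg
  set S : Set E := {q | q ∈ interior X ∧ g q ≤ g x₀} with hS
  have hgc : ContinuousOn g (interior X) := by
    have := hf.contDiffOn.continuousOn
    fun_prop
  have hclosed : IsClosed S := by
    refine isClosed_of_closure_subset fun x hx => ?_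
    have hxX : x ∈ X := hXc.closure_subset_iff.2 interior_subset
      (closure_mono (fun q hq => hq.1 : S ⊆ interior X) hx)
    have hfr : ∃ᶠ q in 𝓝 x, q ∈ S := mem_closure_iff_frequently.1 hx
    by_cases hxi : x ∈ interior X
    · refine ⟨hxi, ?_⟩
      have hc : ContinuousAt g x := hgc.continuousAt (isOpen_interior.mem_nhds hxi)
      by_contra! hlt
      exact hfr ((hc.eventually (lt_mem_nhds hlt)).mono fun q hq hq' => not_le.2 hq hq'.2)
    · have hb : x ∈ frontier X := by
        rw [hXc.frontier_eq]
        exact ⟨hxX, hxi⟩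
      have := (hf.isBarrier x hb).eventually (eventually_gt_atTop (g x₀ / μ ^ 2))
      rw [eventually_nhdsWithin_iff] at this
      refine absurd hfr (not_frequently.2 (this.mono fun q hq hq' => ?_))
      have h1 := hq hq'.1
      rw [div_lt_iff₀ hμ2] at h1
      have h2 : μ ^ 2 * f q ≤ g x₀ := by
        refine le_trans ?_ hq'.2
        simp only [hg]
        have : 0 ≤ ‖q - z‖ ^ 2 / 2 := by positivity
        linarith
      linarith
  have hbdd : Bornology.IsBounded S := by
    set ℓ := ‖fderiv ℝ f x₀‖ with hℓ
    set R := ‖x₀ - z‖ with hR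
    have hℓ0 : 0 ≤ ℓ := norm_nonneg _
    have hR0 : 0 ≤ R := norm_nonneg _
    refine (Metric.isBounded_closedBall (x := z) (r := R + 4 * (μ ^ 2 * ℓ))).subset
      fun q hq => ?_
    rw [mem_closedBall_iff_norm]
    have h1 := hf.add_fderiv_le hX hx₀ hq.1
    have h2 : -(ℓ * (‖q - z‖ + R)) ≤ fderiv ℝ f x₀ (q - x₀) := by
      have h3 : |fderiv ℝ f x₀ (q - x₀)| ≤ ℓ * ‖q - x₀‖ := (fderiv ℝ f x₀).le_opNorm _
      have h4 : ‖q - x₀‖ ≤ ‖q - z‖ + R := by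
        rw [hR, norm_sub_rev x₀ z]
        exact norm_sub_le_norm_sub_add_norm_sub q z x₀
      have h5 := mul_le_mul_of_nonneg_left h4 hℓ0
      linarith [neg_abs_le (fderiv ℝ f x₀ (q - x₀))]
    have h6 := hq.2
    simp only [hg] at h6
    have h7 : μ ^ 2 * (f x₀ - ℓ * (‖q - z‖ + R)) ≤ μ ^ 2 * f q :=
      mul_le_mul_of_nonneg_left (by linarith) hμ2.le
    set c := μ ^ 2 * ℓ with hc
    have hc0 : 0 ≤ c := by positivity
    -- Factoring `‖q - z‖² - R²` shows `‖q - z‖ ≤ R + 2c`; the chosen radius is generous.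
    have h8 : ‖q - z‖ ^ 2 ≤ R ^ 2 + 2 * c * (‖q - z‖ + R) := by
      rw [hc]; nlinarith
    by_contra! hlt
    have := norm_nonneg (q - z)
    nlinarith
  have hcomp : IsCompact S := Metric.isCompact_of_isClosed_isBounded hclosed hbdd
  obtain ⟨q, hq, hmin⟩ := hcomp.exists_isMinOn ⟨x₀, hx₀, le_rfl⟩
    (hgc.mono fun q hq => hq.1)
  refine ⟨q, hq.1, ?_⟩
  have hloc : IsLocalMin g q := by
    filter_upwards [isOpen_interior.mem_nhds hq.1] with p hp
    by_cases hp' : g p ≤ g x₀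
    · exact hmin ⟨hp, hp'⟩
    · exact hq.2.trans (not_le.1 hp').le
  have hder : HasFDerivAt g ((1 / 2 : ℝ) • ((2 : ℝ) • innerSL ℝ (q - z)) +
      μ ^ 2 • fderiv ℝ f q) q := by
    have h1 : HasFDerivAt (fun q : E => ‖q - z‖ ^ 2) ((2 : ℝ) • innerSL ℝ (q - z)) q := by
      have := ((hasFDerivAt_id q).sub_const z).norm_sq
      simpa [two_smul] using this
    have h2 := (h1.const_mul (1 / 2 : ℝ)).add ((hf.hasFDerivAt hq.1).const_mul (μ ^ 2))
    refine h2.congr_of_eventuallyEq (Eventually.of_forall fun p => ?_)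
    simp only [hg, Pi.add_apply]
    ring
  have hz := hloc.hasFDerivAt_eq_zero hder
  rw [← sub_eq_zero]
  refine ext_inner_right ℝ fun v => ?_
  have hv := DFunLike.congr_fun hz v
  simp only [add_apply, smul_apply, innerSL_apply_apply, zero_apply, smul_eq_mul] at hv
  rw [inner_zero_left, show q + μ ^ 2 • gradient f q - z = (q - z) + μ ^ 2 • gradient f q by abel,
    inner_add_left, real_inner_smul_left, inner_gradient_left]
  linarith

end IsSelfConcordantBarrier

end Barrier

/-! ### The smoothing approximation: dependence on the point and on `μ`. -/

section Smoothing

variable {E : Type*} [NormedAddCommGroup E] [InnerProductSpace ℝ E]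
  {X : Set E} {f : E → ℝ} {ϑ : ℝ}

lemma proj_spec [CompleteSpace E] (hX : Convex ℝ X) (hXc : IsClosed X) (hXn : X.Nonempty)
    (z : E) : proj X z ∈ X ∧ ∀ x ∈ X, inner ℝ (z - proj X z) (x - proj X z) ≤ 0 := by
  have hne : ∃ q, q ∈ X ∧ ∀ x ∈ X, ‖q - z‖ ≤ ‖x - z‖ := by
    obtain ⟨v, hv, he⟩ := exists_norm_eq_iInf_of_complete_convex hXn hXc.isComplete hX z
    refine ⟨v, hv, fun x hx => ?_⟩
    rw [norm_sub_rev, he, norm_sub_rev x z]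
    exact ciInf_le ⟨0, by rintro _ ⟨w, rfl⟩; exact norm_nonneg _⟩ (⟨x, hx⟩ : X)
  obtain ⟨h1, h2⟩ : proj X z ∈ X ∧ ∀ x ∈ X, ‖proj X z - z‖ ≤ ‖x - z‖ :=
    Classical.epsilon_spec hne
  refine ⟨h1, (norm_eq_iInf_iff_real_inner_le_zero hX h1).1 ?_⟩
  have : Nonempty X := ⟨⟨_, h1⟩⟩
  refine le_antisymm (le_ciInf fun w => ?_)
    (ciInf_le ⟨0, by rintro _ ⟨w, rfl⟩; exact norm_nonneg _⟩ (⟨_, h1⟩ : X))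
  rw [norm_sub_rev, norm_sub_rev z]
  exact h2 w w.2

lemma smoothing_zero [CompleteSpace E] (z : E) : smoothing X f 0 z = proj X z := by
  simp [smoothing]

lemma exists_equiv_of_norm_sq_le_inner [FiniteDimensional ℝ E] {A : E →L[ℝ] E}
    (hA : ∀ h, ‖h‖ ^ 2 ≤ inner ℝ (A h) h) : ∃ e : E ≃L[ℝ] E, (e : E →L[ℝ] E) = A := by
  have hinj : Function.Injective (A : E →ₗ[ℝ] E) := by
    rw [← LinearMap.ker_eq_bot, LinearMap.ker_eq_bot']
    intro h hh
    have h1 := hA h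
    rw [show A h = 0 from hh, inner_zero_left] at h1
    have : ‖h‖ = 0 := by nlinarith [norm_nonneg h]
    simpa using this
  refine ⟨(LinearEquiv.ofInjectiveEndo (A : E →ₗ[ℝ] E) hinj).toContinuousLinearEquiv, ?_⟩
  ext x
  rfl

namespace IsSelfConcordantBarrier

variable [FiniteDimensional ℝ E] [CompleteSpace E]

section Gradient

variable (hf : IsSelfConcordantBarrier X f ϑ)
include hf

omit [FiniteDimensional ℝ E] in
lemma contDiffOn_gradient : ContDiffOn ℝ 2 (gradient f) (interior X) :=
  (InnerProductSpace.toDual ℝ E).symm.contDiff.comp_contDiffOn hf.contDiffOn_fderiv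

omit [FiniteDimensional ℝ E] in
lemma hasFDerivAt_gradient {x : E} (hx : x ∈ interior X) :
    HasFDerivAt (gradient f) (fderiv ℝ (gradient f) x) x :=
  ((hf.contDiffOn_gradient.contDiffAt (isOpen_interior.mem_nhds hx)).differentiableAt
    (by norm_num)).hasFDerivAt

omit [FiniteDimensional ℝ E] in
lemma inner_fderiv_gradient_nonneg {x : E} (hx : x ∈ interior X) (h : E) :
    0 ≤ inner ℝ (fderiv ℝ (gradient f) x h) h := by
  have h1 := (InnerProductSpace.toDual ℝ E).toContinuousLinearEquiv.hasFDerivAt.comp x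
    (hf.hasFDerivAt_gradient hx)
  have h2 : ((InnerProductSpace.toDual ℝ E).toContinuousLinearEquiv : E → _) ∘ gradient f =
      fderiv ℝ f := by
    ext y v
    simp
  rw [h2] at h1
  have h3 := hf.hessian_nonneg hx h
  rw [h1.fderiv] at h3
  exact h3

omit [FiniteDimensional ℝ E] in
lemma norm_sq_le_inner {x : E} (hx : x ∈ interior X) (μ : ℝ) (h : E) :
    ‖h‖ ^ 2 ≤ inner ℝ
      ((ContinuousLinearMap.id ℝ E + μ ^ 2 • fderiv ℝ (gradient f) x) h) h := by
  have := mul_nonneg (sq_nonneg μ) (hf.inner_fderiv_gradient_nonneg hx h)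
  rw [add_apply, smul_apply, inner_add_left, real_inner_smul_left]
  simp only [ContinuousLinearMap.id_apply, real_inner_self_eq_norm_sq]
  linarith

end Gradient

variable (hf : IsSelfConcordantBarrier X f ϑ) (hX : Convex ℝ X) (hXc : IsClosed X)
  (hXi : (interior X).Nonempty)
include hf hX hXc hXi

lemma smoothing_spec {μ : ℝ} (hμ : μ ≠ 0) (z : E) :
    smoothing X f μ z ∈ interior X ∧
      smoothing X f μ z + μ ^ 2 • gradient f (smoothing X f μ z) = z := by
  have : smoothing X f μ z =
      Classical.epsilon fun q => q ∈ interior X ∧ q + μ ^ 2 • gradient f q = z := by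
    simp [smoothing, hμ]
  rw [this]
  exact Classical.epsilon_spec (hf.exists_add_smul_gradient_eq hX hXc hXi hμ z)

/-- `p_μ` is the resolvent of the monotone operator `μ² ∇f`, hence nonexpansive. -/
lemma norm_smoothing_sub_le {μ : ℝ} (hμ : μ ≠ 0) (z z' : E) :
    ‖smoothing X f μ z - smoothing X f μ z'‖ ≤ ‖z - z'‖ := by
  obtain ⟨h1, h2⟩ := hf.smoothing_spec hX hXc hXi hμ z
  obtain ⟨h1', h2'⟩ := hf.smoothing_spec hX hXc hXi hμ z'
  set p := smoothing X f μ z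
  set q := smoothing X f μ z'
  have hm := hf.fderiv_mono hX h1' h1
  rw [← inner_gradient_left, ← inner_gradient_left] at hm
  have he : z - z' = (p - q) + μ ^ 2 • (gradient f p - gradient f q) := by
    rw [← h2, ← h2', smul_sub]; abel
  have h3 : ‖p - q‖ ^ 2 ≤ inner ℝ (z - z') (p - q) := by
    rw [he, inner_add_left, real_inner_self_eq_norm_sq, real_inner_smul_left, inner_sub_left]
    nlinarith [sq_nonneg μ]
  have h4 := h3.trans (real_inner_le_norm _ _)
  by_contra! hlt
  nlinarith [norm_nonneg (z - z')]

/-- With `p = p_μ(z)` and `q = p_ν(z)`, `‖p - q‖² = ⟨z - q, p - q⟩ + ⟨z - p, q - p⟩`. For `ν = 0`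
the first term is at most `0` by the projection inequality. For `ν > 0`, monotonicity replaces
`∇f(q)` by `∇f(p)`, leaving `(μ² - ν²) ⟨∇f(p), q - p⟩`. -/
lemma norm_smoothing_sub_sq_le {μ ν : ℝ} (hν : 0 ≤ ν) (hνμ : ν ≤ μ) (z : E) :
    ‖smoothing X f μ z - smoothing X f ν z‖ ^ 2 ≤ ϑ * (μ ^ 2 - ν ^ 2) := by
  rcases hνμ.eq_or_lt with rfl | hlt
  · simp
  have hμ : μ ≠ 0 := (hν.trans_lt hlt).ne'
  obtain ⟨h1, h2⟩ := hf.smoothing_spec hX hXc hXi hμ z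
  set p := smoothing X f μ z
  have hpz : z - p = μ ^ 2 • gradient f p := by rw [← h2]; simp [p]
  rcases hν.eq_or_lt with rfl | hν'
  · rw [smoothing_zero]
    obtain ⟨h3, h4⟩ := proj_spec hX hXc (hXi.mono interior_subset) z
    set q := proj X z
    have h5 := h4 p (interior_subset h1)
    have h6 := hf.fderiv_sub_le hX hXc h1 h3
    have h7 : inner ℝ (z - p) (q - p) ≤ μ ^ 2 * ϑ := by
      rw [hpz, real_inner_smul_left, inner_gradient_left]
      exact mul_le_mul_of_nonneg_left h6 (sq_nonneg μ)
    have h8 : ‖p - q‖ ^ 2 = inner ℝ (z - q) (p - q) + inner ℝ (z - p) (q - p) := by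
      rw [← real_inner_self_eq_norm_sq, show q - p = -(p - q) by abel, inner_neg_right,
        ← sub_eq_add_neg, ← inner_sub_left]
      congr 1; abel
    rw [h8]
    linarith
  · obtain ⟨h3, h4⟩ := hf.smoothing_spec hX hXc hXi hν'.ne' z
    set q := smoothing X f ν z
    have hqz : z - q = ν ^ 2 • gradient f q := by rw [← h4]; simp [q]
    have h5 := hf.fderiv_mono hX h3 h1
    have h6 := hf.fderiv_sub_le hX hXc h1 (interior_subset h3)
    have h7 : fderiv ℝ f p (p - q) = -fderiv ℝ f p (q - p) := by
      rw [← map_neg, neg_sub]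
    have h8 : ‖p - q‖ ^ 2 = inner ℝ (z - q) (p - q) - inner ℝ (z - p) (p - q) := by
      rw [← real_inner_self_eq_norm_sq, ← inner_sub_left]
      congr 1; abel
    rw [h8, hqz, hpz, real_inner_smul_left, real_inner_smul_left, inner_gradient_left,
      inner_gradient_left]
    have h9 : 0 ≤ μ ^ 2 - ν ^ 2 := by nlinarith
    have h10 := mul_le_mul_of_nonneg_left h5 (sq_nonneg ν)
    have h11 := mul_le_mul_of_nonneg_left h6 h9
    rw [h7] at h10 ⊢
    linarith

lemma norm_smoothing_sub_le_sqrt {μ ν : ℝ} (hν : 0 ≤ ν) (hνμ : ν ≤ μ) (z : E) :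
    ‖smoothing X f μ z - smoothing X f ν z‖ ≤ √(ϑ * (μ ^ 2 - ν ^ 2)) :=
  Real.le_sqrt_of_sq_le (hf.norm_smoothing_sub_sq_le hX hXc hXi hν hνμ z)

lemma norm_smoothing_sub_proj_le {μ : ℝ} (hμ : 0 ≤ μ) (z : E) :
    ‖smoothing X f μ z - smoothing X f 0 z‖ ≤ √ϑ * μ := by
  have := hf.norm_smoothing_sub_le_sqrt hX hXc hXi le_rfl hμ z
  rwa [zero_pow two_ne_zero, sub_zero, Real.sqrt_mul hf.parameter_nonneg, Real.sqrt_sq hμ] at this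

lemma tendsto_smoothing_nhdsGT_zero (z : E) :
    Tendsto (fun μ => smoothing X f μ z) (𝓝[>] 0) (𝓝 (smoothing X f 0 z)) := by
  rw [tendsto_iff_norm_sub_tendsto_zero]
  refine squeeze_zero' (Eventually.of_forall fun _ => norm_nonneg _)
    (g := fun μ => √ϑ * μ) ?_ ?_
  · filter_upwards [self_mem_nhdsWithin] with μ hμ
    exact hf.norm_smoothing_sub_proj_le hX hXc hXi (le_of_lt hμ) z
  · have : Tendsto (fun μ : ℝ => √ϑ * μ) (𝓝 0) (𝓝 (√ϑ * 0)) :=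
      (continuous_const.mul continuous_id).tendsto 0
    rw [mul_zero] at this
    exact this.mono_left nhdsWithin_le_nhds

lemma tendsto_smoothing_of_pos {μ : ℝ} (hμ : 0 < μ) (z : E) :
    Tendsto (fun q : E × ℝ => smoothing X f q.2 q.1) (𝓝 z ×ˢ 𝓝 μ) (𝓝 (smoothing X f μ z)) := by
  rw [tendsto_iff_norm_sub_tendsto_zero, ← nhds_prod_eq]
  refine squeeze_zero' (Eventually.of_forall fun _ => norm_nonneg _)
    (g := fun q : E × ℝ => ‖q.1 - z‖ + √(ϑ * |q.2 ^ 2 - μ ^ 2|)) ?_ ?_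
  · have : ∀ᶠ q : E × ℝ in 𝓝 (z, μ), 0 < q.2 :=
      (continuous_snd.tendsto (z, μ)).eventually (lt_mem_nhds hμ)
    filter_upwards [this] with q hq
    refine (norm_sub_le_norm_sub_add_norm_sub _ (smoothing X f q.2 z) _).trans
      (add_le_add (hf.norm_smoothing_sub_le hX hXc hXi hq.ne' _ _) ?_)
    rcases le_total μ q.2 with h | h
    · refine (hf.norm_smoothing_sub_le_sqrt hX hXc hXi hμ.le h z).trans ?_
      exact Real.sqrt_le_sqrt (mul_le_mul_of_nonneg_left (le_abs_self _) hf.parameter_nonneg)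
    · rw [norm_sub_rev, abs_sub_comm]
      refine (hf.norm_smoothing_sub_le_sqrt hX hXc hXi hq.le h z).trans ?_
      exact Real.sqrt_le_sqrt (mul_le_mul_of_nonneg_left (le_abs_self _) hf.parameter_nonneg)
  · have hc : Continuous fun q : E × ℝ => ‖q.1 - z‖ + √(ϑ * |q.2 ^ 2 - μ ^ 2|) := by fun_prop
    simpa using hc.tendsto (z, μ)

/-- `p_μ` is a continuous right inverse of `q ↦ q + μ² ∇f(q)`, whose derivative is coercive by
convexity and so invertible. -/
lemma hasFDerivAt_smoothing {μ : ℝ} (hμ : μ ≠ 0) (z : E) :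
    HasFDerivAt (smoothing X f μ) (ContinuousLinearMap.id ℝ E +
      μ ^ 2 • fderiv ℝ (gradient f) (smoothing X f μ z)).inverse z := by
  have h1 := (hf.smoothing_spec hX hXc hXi hμ z).1
  obtain ⟨e, he⟩ := exists_equiv_of_norm_sq_le_inner (hf.norm_sq_le_inner h1 μ)
  rw [← he, ContinuousLinearMap.inverse_equiv]
  refine HasFDerivAt.of_local_left_inverse (f := fun q => q + μ ^ 2 • gradient f q) ?_ ?_
    (Eventually.of_forall fun y => (hf.smoothing_spec hX hXc hXi hμ y).2)
  · have : LipschitzWith 1 (smoothing X f μ) := LipschitzWith.of_dist_le_mul fun a b => by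
      simpa [dist_eq_norm] using hf.norm_smoothing_sub_le hX hXc hXi hμ a b
    exact this.continuous.continuousAt
  · rw [he]
    exact (hasFDerivAt_id _).add ((hf.hasFDerivAt_gradient h1).const_smul (μ ^ 2))

lemma tendsto_fderiv_smoothing_of_pos {μ : ℝ} (hμ : 0 < μ) (z : E) :
    Tendsto (fun q : E × ℝ => fderiv ℝ (smoothing X f q.2) q.1) (𝓝 z ×ˢ 𝓝 μ)
      (𝓝 (fderiv ℝ (smoothing X f μ) z)) := by
  have h1 := (hf.smoothing_spec hX hXc hXi hμ.ne' z).1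
  have hpos : ∀ᶠ q : E × ℝ in 𝓝 z ×ˢ 𝓝 μ, 0 < q.2 :=
    tendsto_snd.eventually (lt_mem_nhds hμ)
  have hc : ContinuousAt (fderiv ℝ (gradient f)) (smoothing X f μ z) :=
    (hf.contDiffOn_gradient.continuousOn_fderiv_of_isOpen isOpen_interior (by norm_num)).continuousAt
      (isOpen_interior.mem_nhds h1)
  have h2 : Tendsto (fun q : E × ℝ => ContinuousLinearMap.id ℝ E +
      q.2 ^ 2 • fderiv ℝ (gradient f) (smoothing X f q.2 q.1)) (𝓝 z ×ˢ 𝓝 μ)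
      (𝓝 (ContinuousLinearMap.id ℝ E + μ ^ 2 • fderiv ℝ (gradient f) (smoothing X f μ z))) :=
    tendsto_const_nhds.add ((tendsto_snd.pow 2).smul
      (hc.tendsto.comp (hf.tendsto_smoothing_of_pos hX hXc hXi hμ z)))
  obtain ⟨e, he⟩ := exists_equiv_of_norm_sq_le_inner (hf.norm_sq_le_inner h1 μ)
  have h3 : ContinuousAt ContinuousLinearMap.inverse (ContinuousLinearMap.id ℝ E +
      μ ^ 2 • fderiv ℝ (gradient f) (smoothing X f μ z)) := by
    rw [← he]
    exact (contDiffAt_map_inverse (n := 0) e).continuousAt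
  rw [(hf.hasFDerivAt_smoothing hX hXc hXi hμ.ne' z).fderiv]
  refine (h3.tendsto.comp h2).congr' ?_
  filter_upwards [hpos] with q hq
  exact (hf.hasFDerivAt_smoothing hX hXc hXi hq.ne' q.1).fderiv.symm

end IsSelfConcordantBarrier

end Smoothing

/-! ### Linearization uniform in a parameter. -/

section UniformLinearization

variable {ι V W : Type*} [NormedAddCommGroup V] [NormedSpace ℝ V] [NormedAddCommGroup W]
  [NormedSpace ℝ W]

/-- If the derivatives of the maps `g i` converge jointly to `A` near `v₀`, then the `g i` are
eventually approximated by `A`, uniformly near `v₀`. -/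
lemma exists_ball_linearization {g : ι → V → W} {l : Filter ι} {v₀ : V} {A : V →L[ℝ] W}
    (hd : ∀ᶠ i in l, Differentiable ℝ (g i))
    (h : Tendsto (fun q : V × ι => fderiv ℝ (g q.2) q.1) (𝓝 v₀ ×ˢ l) (𝓝 A))
    {ε : ℝ} (hε : 0 < ε) :
    ∃ δ > 0, ∀ᶠ i in l, ∀ u ∈ Metric.ball v₀ δ, ‖fderiv ℝ (g i) u - A‖ ≤ ε ∧
      ∀ v ∈ Metric.ball v₀ δ, ‖g i u - g i v - A (u - v)‖ ≤ ε * ‖u - v‖ := by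
  have h1 := h.eventually (Metric.closedBall_mem_nhds A hε)
  obtain ⟨p, hp, q, hq, hpq⟩ := eventually_prod_iff.1 h1
  obtain ⟨δ, hδ, hball⟩ := Metric.eventually_nhds_iff_ball.1 hp
  refine ⟨δ, hδ, ?_⟩
  filter_upwards [hq, hd] with i hi hdi
  have hb : ∀ u ∈ Metric.ball v₀ δ, ‖fderiv ℝ (g i) u - A‖ ≤ ε := fun u hu => by
    simpa [dist_eq_norm] using hpq (hball u hu) hi
  -- Mean value inequality for `g i - A` on the convex ball.
  exact fun u hu => ⟨hb u hu, fun v hv => Convex.norm_image_sub_le_of_norm_fderiv_le'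
    (fun x _ => hdi x) hb (convex_ball v₀ δ) hv hu⟩

end UniformLinearization

/-! ### The smoothed natural map, its derivative and the merit function. -/

section NatMap

variable {E : Type*} [NormedAddCommGroup E] [InnerProductSpace ℝ E]

omit [InnerProductSpace ℝ E] in
lemma norm_fst_add_norm_snd_le (h : WithLp 2 (E × E)) : ‖h.snd‖ + ‖h.fst‖ ≤ √2 * ‖h‖ := by
  rw [WithLp.prod_norm_eq_of_L2, ← Real.sqrt_mul (by norm_num)]
  refine Real.le_sqrt_of_sq_le ?_
  nlinarith [sq_nonneg (‖h.snd‖ - ‖h.fst‖)]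

omit [InnerProductSpace ℝ E] in
-- The second factor is general because the bound also serves for pairs `(z - z*, μ)` in `E × ℝ`.
lemma norm_le_norm_snd_add_norm_fst {G : Type*} [NormedAddCommGroup G] (h : WithLp 2 (E × G)) : ‖h‖ ≤ ‖h.snd‖ + ‖h.fst‖ := by
  rw [WithLp.prod_norm_eq_of_L2]
  refine Real.sqrt_le_iff.2 ⟨by positivity, ?_⟩
  nlinarith [mul_nonneg (norm_nonneg h.snd) (norm_nonneg h.fst)]

omit [InnerProductSpace ℝ E] in
lemma norm_fst_le (h : WithLp 2 (E × E)) : ‖h.fst‖ ≤ ‖h‖ := by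
  rw [WithLp.prod_norm_eq_of_L2]
  exact Real.le_sqrt_of_sq_le (by nlinarith [sq_nonneg ‖h.snd‖])

omit [InnerProductSpace ℝ E] in
lemma norm_snd_le (h : WithLp 2 (E × E)) : ‖h.snd‖ ≤ ‖h‖ := by
  rw [WithLp.prod_norm_eq_of_L2]
  exact Real.le_sqrt_of_sq_le (by nlinarith [sq_nonneg ‖h.fst‖])

/-- The derivative of the natural map, in terms of the derivatives `S` of the smoothing
approximation and `G` of `F`. -/
def natMapDeriv (S G : E →L[ℝ] E) : WithLp 2 (E × E) →L[ℝ] WithLp 2 (E × E) :=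
  ((WithLp.prodContinuousLinearEquiv 2 ℝ E E).symm.toContinuousLinearMap ∘L
      ContinuousLinearMap.inl ℝ E E) ∘L
    (WithLp.fstL 2 ℝ E E - S ∘L (WithLp.fstL 2 ℝ E E - WithLp.sndL 2 ℝ E E)) +
  ((WithLp.prodContinuousLinearEquiv 2 ℝ E E).symm.toContinuousLinearMap ∘L
      ContinuousLinearMap.inr ℝ E E) ∘L
    (G ∘L WithLp.fstL 2 ℝ E E - WithLp.sndL 2 ℝ E E)

@[simp]
lemma natMapDeriv_apply_fst (S G : E →L[ℝ] E) (h : WithLp 2 (E × E)) :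
    (natMapDeriv S G h).fst = h.fst - S (h.fst - h.snd) := by
  simp [natMapDeriv]

@[simp]
lemma natMapDeriv_apply_snd (S G : E →L[ℝ] E) (h : WithLp 2 (E × E)) :
    (natMapDeriv S G h).snd = G h.fst - h.snd := by
  simp [natMapDeriv]

lemma continuous_natMapDeriv :
    Continuous fun q : (E →L[ℝ] E) × (E →L[ℝ] E) => natMapDeriv q.1 q.2 := by
  unfold natMapDeriv
  fun_prop

variable [CompleteSpace E] {X : Set E} {f : E → ℝ} {F : E → E}

lemma hasFDerivAt_natMap {μ : ℝ} {S G : E →L[ℝ] E} {w : WithLp 2 (E × E)}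
    (hS : HasFDerivAt (smoothing X f μ) S (w.fst - w.snd)) (hG : HasFDerivAt F G w.fst) :
    HasFDerivAt (natMap X f F μ) (natMapDeriv S G) w := by
  have h1 : HasFDerivAt (fun w : WithLp 2 (E × E) => w.fst) (WithLp.fstL 2 ℝ E E) w :=
    (WithLp.fstL 2 ℝ E E).hasFDerivAt
  have h2 : HasFDerivAt (fun w : WithLp 2 (E × E) => w.snd) (WithLp.sndL 2 ℝ E E) w :=
    (WithLp.sndL 2 ℝ E E).hasFDerivAt
  have h3 := h1.sub (hS.comp w (h1.sub h2))
  have h4 := (hG.comp w h1).sub h2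
  refine (((ContinuousLinearMap.hasFDerivAt _).comp w h3).add
    ((ContinuousLinearMap.hasFDerivAt _).comp w h4)).congr_of_eventuallyEq
    (Eventually.of_forall fun v => ?_)
  refine WithLp.ofLp_injective 2 (Prod.ext ?_ ?_) <;> simp [natMap, phi]

lemma natMap_fst (μ : ℝ) (w : WithLp 2 (E × E)) :
    (natMap X f F μ w).fst = w.fst - smoothing X f μ (w.fst - w.snd) := rfl

lemma natMap_snd (μ : ℝ) (w : WithLp 2 (E × E)) :
    (natMap X f F μ w).snd = F w.fst - w.snd := rfl

lemma merit_eq (μ : ℝ) (w : WithLp 2 (E × E)) :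
    merit X f F μ w = ‖(natMap X f F μ w).snd‖ + ‖(natMap X f F μ w).fst‖ := rfl

lemma merit_nonneg (μ : ℝ) (w : WithLp 2 (E × E)) : 0 ≤ merit X f F μ w := by
  rw [merit_eq]; positivity

lemma merit_le (μ : ℝ) (w : WithLp 2 (E × E)) :
    merit X f F μ w ≤ √2 * ‖natMap X f F μ w‖ := by
  rw [merit_eq]
  exact norm_fst_add_norm_snd_le _

lemma norm_natMap_le_merit (μ : ℝ) (w : WithLp 2 (E × E)) :
    ‖natMap X f F μ w‖ ≤ merit X f F μ w := by
  rw [merit_eq]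
  exact norm_le_norm_snd_add_norm_fst _

lemma natMap_eq_zero_of_merit_le {μ : ℝ} {w : WithLp 2 (E × E)} (h : merit X f F μ w ≤ 0) :
    natMap X f F μ w = 0 :=
  norm_le_zero_iff.1 ((norm_natMap_le_merit μ w).trans h)

lemma merit_le_merit_add (μ ν : ℝ) (w : WithLp 2 (E × E)) :
    merit X f F ν w ≤ merit X f F μ w +
      ‖smoothing X f μ (w.fst - w.snd) - smoothing X f ν (w.fst - w.snd)‖ := by
  have : phi X f ν w = phi X f μ w +
      (smoothing X f μ (w.fst - w.snd) - smoothing X f ν (w.fst - w.snd)) := by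
    simp only [phi]; abel
  unfold merit
  rw [this, add_assoc]
  gcongr
  exact norm_add_le _ _

namespace IsSelfConcordantBarrier

variable [FiniteDimensional ℝ E] {ϑ : ℝ}
  (hf : IsSelfConcordantBarrier X f ϑ) (hX : Convex ℝ X) (hXc : IsClosed X)
  (hXi : (interior X).Nonempty)
include hf hX hXc hXi

lemma merit_le_merit_add_sqrt {μ ν : ℝ} (hν : 0 ≤ ν) (hνμ : ν ≤ μ) (w : WithLp 2 (E × E)) :
    merit X f F ν w ≤ merit X f F μ w + √(ϑ * (μ ^ 2 - ν ^ 2)) :=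
  (merit_le_merit_add μ ν w).trans
    (add_le_add_right (hf.norm_smoothing_sub_le_sqrt hX hXc hXi hν hνμ _) _)

lemma merit_zero_le {μ : ℝ} (hμ : 0 ≤ μ) (w : WithLp 2 (E × E)) :
    merit X f F 0 w ≤ merit X f F μ w + √ϑ * μ :=
  (merit_le_merit_add μ 0 w).trans
    (add_le_add_right (hf.norm_smoothing_sub_proj_le hX hXc hXi hμ _) _)

lemma merit_le_merit_zero_add {μ : ℝ} (hμ : 0 ≤ μ) (w : WithLp 2 (E × E)) :
    merit X f F μ w ≤ merit X f F 0 w + √ϑ * μ := by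
  refine (merit_le_merit_add 0 μ w).trans (add_le_add_right ?_ _)
  rw [norm_sub_rev]
  exact hf.norm_smoothing_sub_proj_le hX hXc hXi hμ _

lemma hasFDerivAt_natMap_of_ne_zero (hF : Differentiable ℝ F) {μ : ℝ} (hμ : μ ≠ 0)
    (w : WithLp 2 (E × E)) : HasFDerivAt (natMap X f F μ)
      (natMapDeriv (fderiv ℝ (smoothing X f μ) (w.fst - w.snd)) (fderiv ℝ F w.fst)) w :=
  hasFDerivAt_natMap
    (hf.hasFDerivAt_smoothing hX hXc hXi hμ _).differentiableAt.hasFDerivAt (hF _).hasFDerivAt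

lemma tendsto_fderiv_natMap (hF : ContDiff ℝ 1 F) {l : Filter ℝ} (hl : ∀ᶠ μ in l, μ ≠ 0)
    {w : WithLp 2 (E × E)} {S : E →L[ℝ] E}
    (hS : Tendsto (fun q : E × ℝ => fderiv ℝ (smoothing X f q.2) q.1)
      (𝓝 (w.fst - w.snd) ×ˢ l) (𝓝 S)) :
    Tendsto (fun q : WithLp 2 (E × E) × ℝ => fderiv ℝ (natMap X f F q.2) q.1) (𝓝 w ×ˢ l)
      (𝓝 (natMapDeriv S (fderiv ℝ F w.fst))) := by
  have hfst : Continuous fun w : WithLp 2 (E × E) => w.fst := (WithLp.fstL 2 ℝ E E).continuous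
  have hsnd : Continuous fun w : WithLp 2 (E × E) => w.snd := (WithLp.sndL 2 ℝ E E).continuous
  have h1 : Tendsto (fun q : WithLp 2 (E × E) × ℝ => (q.1.fst - q.1.snd, q.2)) (𝓝 w ×ˢ l)
      (𝓝 (w.fst - w.snd) ×ˢ l) :=
    (((hfst.sub hsnd).tendsto w).comp tendsto_fst).prodMk tendsto_snd
  have h2 : Tendsto (fun q : WithLp 2 (E × E) × ℝ => fderiv ℝ F q.1.fst) (𝓝 w ×ˢ l)
      (𝓝 (fderiv ℝ F w.fst)) :=
    (((hF.continuous_fderiv (by norm_num)).comp hfst).tendsto w).comp tendsto_fst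
  refine ((continuous_natMapDeriv.tendsto (S, fderiv ℝ F w.fst)).comp
    ((hS.comp h1).prodMk_nhds h2)).congr' ?_
  filter_upwards [tendsto_snd.eventually hl] with q hq
  exact ((hf.hasFDerivAt_natMap_of_ne_zero hX hXc hXi (hF.differentiable (by norm_num)) hq
    q.1).fderiv).symm

lemma tendsto_natMap_nhdsGT_zero (w : WithLp 2 (E × E)) :
    Tendsto (fun μ => natMap X f F μ w) (𝓝[>] 0) (𝓝 (natMap X f F 0 w)) := by
  have h1 : Tendsto (fun μ => (phi X f μ w, F w.fst - w.snd)) (𝓝[>] 0)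
      (𝓝 (phi X f 0 w, F w.fst - w.snd)) :=
    (tendsto_const_nhds.sub
      (hf.tendsto_smoothing_nhdsGT_zero hX hXc hXi _)).prodMk_nhds tendsto_const_nhds
  exact ((WithLp.prodContinuousLinearEquiv 2 ℝ E E).symm.continuous.tendsto _).comp h1

/-- Near a point where the derivatives of the smoothing approximations converge, both the smoothed
natural maps for small `μ` and the natural map itself are approximated by a linear map. -/
lemma exists_ball_natMap_linearization (hF : ContDiff ℝ 1 F) {w : WithLp 2 (E × E)}
    {T : E →L[ℝ] E}
    (hT : Tendsto (fun q : E × ℝ => fderiv ℝ (smoothing X f q.2) q.1)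
      (𝓝 (w.fst - w.snd) ×ˢ 𝓝[>] (0 : ℝ)) (𝓝 T)) {ε : ℝ} (hε : 0 < ε) :
    ∃ δ > 0, (∀ᶠ μ in 𝓝[>] (0 : ℝ), ∀ u ∈ Metric.ball w δ,
        ‖fderiv ℝ (natMap X f F μ) u - natMapDeriv T (fderiv ℝ F w.fst)‖ ≤ ε) ∧
      ∀ u ∈ Metric.ball w δ, ∀ v ∈ Metric.ball w δ,
        ‖natMap X f F 0 u - natMap X f F 0 v - natMapDeriv T (fderiv ℝ F w.fst) (u - v)‖ ≤
          ε * ‖u - v‖ := by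
  have hl : ∀ᶠ μ in 𝓝[>] (0 : ℝ), μ ≠ 0 := by
    filter_upwards [self_mem_nhdsWithin] with μ hμ using ne_of_gt hμ
  obtain ⟨δ, hδ, h⟩ := exists_ball_linearization (g := natMap X f F)
    (hl.mono fun μ hμ u => (hf.hasFDerivAt_natMap_of_ne_zero hX hXc hXi
      (hF.differentiable (by norm_num)) hμ u).differentiableAt)
    (hf.tendsto_fderiv_natMap hX hXc hXi hF hl hT) hε
  refine ⟨δ, hδ, h.mono fun μ hμ u hu => (hμ u hu).1, fun u hu v hv => ?_⟩
  -- `H_0` need not be differentiable off `w`; its estimate is the pointwise limit of those for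
  -- `H_μ` as `μ` decreases to `0`.
  refine le_of_tendsto (((hf.tendsto_natMap_nhdsGT_zero hX hXc hXi u).sub
    (hf.tendsto_natMap_nhdsGT_zero hX hXc hXi v)).sub_const _).norm ?_
  exact h.mono fun μ hμ => (hμ u hu).2 v hv

end IsSelfConcordantBarrier

end NatMap

/-! ### Invariants of the run and convergence of `μ_k` to zero. -/

section Run

variable {E : Type*} [NormedAddCommGroup E] [InnerProductSpace ℝ E] [CompleteSpace E]
  {X : Set E} {f : E → ℝ} {F : E → E} {ϑ : ℝ} {P : Params} {I : Iterates E}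

lemma Params.Valid.β_pos (hP : P.Valid ϑ) : 0 < P.β := (Real.sqrt_nonneg ϑ).trans_lt hP.β_gt

lemma Params.Valid.θ₁_le (hP : P.Valid ϑ) (k : ℕ) : P.θ₁ k ≤ ⨆ k, P.θ₁ k :=
  le_ciSup ⟨1, by rintro _ ⟨k, rfl⟩; exact (hP.θ₁_mem k).2.le⟩ k

/-- A bound for the inverses of the derivatives along the run, with positive constant. -/
lemma UniformlyNonsingular.exists_norm_le (h : UniformlyNonsingular X f F I) :
    ∃ C > 0, ∀ k h, ‖h‖ ≤ C * ‖fderiv ℝ (natMap X f F (I.mu k)) (I.w k) h‖ := by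
  obtain ⟨C, hC⟩ := h
  refine ⟨max C 1, by positivity, fun k h => ?_⟩
  set D := fderiv ℝ (natMap X f F (I.mu k)) (I.w k)
  calc ‖h‖ = ‖D.inverse (D h)‖ := by rw [(hC k).1.inverse_apply_self]
    _ ≤ ‖D.inverse‖ * ‖D h‖ := D.inverse.le_opNorm _
    _ ≤ max C 1 * ‖D h‖ :=
      mul_le_mul_of_nonneg_right ((hC k).2.trans (le_max_left _ _)) (norm_nonneg _)

namespace IsInfiniteRun

variable (hI : IsInfiniteRun X f F P I) (hP : P.Valid ϑ)
include hI hP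

lemma gam_mem (k : ℕ) : 0 < I.gam k ∧ I.gam k ≤ P.α₂ := by
  obtain ⟨⟨j, hj⟩, hmem⟩ := (hI.gam_greatest k).1
  have hα := hP.α₂_mem
  refine ⟨hj ▸ pow_pos hα.1 j, ?_⟩
  -- The exponent `0` would mean `γ = 1` and `μ̃ = 0`. Then the next iterate, whether accepted or
  -- rejected, would solve `H_0 = 0`, against nontermination.
  rcases j with _ | j
  · exfalso
    have h1 : I.gam k = 1 := by simpa using hj
    rw [h1, sub_self, zero_mul] at hmem
    have hz : I.muTilde (k + 1) = 0 := by rw [hI.muTilde_eq, h1, sub_self, zero_mul]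
    by_cases hacc : I.wHat (k + 1) ∈ nbhd X f F P.β (I.muTilde (k + 1))
    · refine (hI.accepted k hacc).1 (natMap_eq_zero_of_merit_le ?_)
      rw [hz] at hacc
      simpa [nbhd] using hacc
    · refine hI.not_solved (k + 1) (natMap_eq_zero_of_merit_le ?_)
      rw [(hI.rejected k hacc).2]
      simpa [nbhd] using hmem
  · rw [hj, pow_succ]
    exact mul_le_of_le_one_left hα.1.le (pow_le_one₀ hα.1.le hα.2.le)

lemma eta_mem {k : ℕ} (hacc : I.wHat (k + 1) ∈ nbhd X f F P.β (I.muTilde (k + 1))) :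
    0 < I.eta k ∧ I.eta k ≤ 1 := by
  obtain ⟨⟨⟨j, hj⟩, -⟩, -⟩ := (hI.accepted k hacc).2.1
  exact hj ▸ ⟨pow_pos hP.α₃_mem.1 j, pow_le_one₀ hP.α₃_mem.1.le hP.α₃_mem.2.le⟩

lemma mu_pos (k : ℕ) : 0 < I.mu k := by
  induction k with
  | zero => exact hI.mu_zero_pos
  | succ k ih =>
    have h1 : 0 < I.muTilde (k + 1) := by
      rw [hI.muTilde_eq]
      exact mul_pos (by linarith [(hI.gam_mem hP k).2, hP.α₂_mem.2]) ih
    by_cases hacc : I.wHat (k + 1) ∈ nbhd X f F P.β (I.muTilde (k + 1))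
    · rw [(hI.accepted k hacc).2.2.1]
      exact mul_pos (hI.eta_mem hP hacc).1 h1
    · rwa [(hI.rejected k hacc).1]

lemma le_muTilde (k : ℕ) : (1 - P.α₂) * I.mu k ≤ I.muTilde (k + 1) := by
  rw [hI.muTilde_eq]
  exact mul_le_mul_of_nonneg_right (by linarith [(hI.gam_mem hP k).2]) (hI.mu_pos hP k).le

lemma muTilde_pos (k : ℕ) : 0 < I.muTilde (k + 1) :=
  (mul_pos (by linarith [hP.α₂_mem.2]) (hI.mu_pos hP k)).trans_le (hI.le_muTilde hP k)

lemma mu_succ_le_muTilde (k : ℕ) : I.mu (k + 1) ≤ I.muTilde (k + 1) := by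
  by_cases hacc : I.wHat (k + 1) ∈ nbhd X f F P.β (I.muTilde (k + 1))
  · rw [(hI.accepted k hacc).2.2.1]
    exact mul_le_of_le_one_left (hI.muTilde_pos hP k).le (hI.eta_mem hP hacc).2
  · exact (hI.rejected k hacc).1.le

lemma antitone_mu : Antitone I.mu := antitone_nat_of_succ_le fun k => by
  refine (hI.mu_succ_le_muTilde hP k).trans ?_
  rw [hI.muTilde_eq]
  exact mul_le_of_le_one_left (hI.mu_pos hP k).le (by linarith [(hI.gam_mem hP k).1])

lemma merit_le (k : ℕ) : merit X f F (I.mu k) (I.w k) ≤ P.β * I.mu k := by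
  rcases k with _ | k
  · exact hI.w_zero_mem
  by_cases hacc : I.wHat (k + 1) ∈ nbhd X f F P.β (I.muTilde (k + 1))
  · obtain ⟨-, ⟨⟨⟨j, hj⟩, -⟩, hub⟩, hmu, hw⟩ := hI.accepted k hacc
    rw [hmu, hw]
    rcases j with _ | j
    · rw [hj, pow_zero, one_mul]
      exact hacc
    · by_contra hnot
      have hα := hP.α₃_mem
      -- For `η = α₃ ^ (j + 1)`, maximality says that `α₃ ^ j` is not admissible, which is
      -- membership in the neighbourhood with parameter `η μ̃`.
      have h1 : P.α₃ ^ j ≤ I.eta k := hub ⟨⟨j, rfl⟩, fun h => hnot (by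
        rw [← pow_succ, ← hj] at h
        exact h)⟩
      rw [hj, pow_succ] at h1
      nlinarith [pow_pos hα.1 j, hα.2]
  · obtain ⟨hmu, hw⟩ := hI.rejected k hacc
    rw [hmu, hw, hI.muTilde_eq]
    exact (hI.gam_greatest k).1.2

lemma norm_dTilde_le {C : ℝ} (hC0 : 0 ≤ C)
    (hC : ∀ k h, ‖h‖ ≤ C * ‖fderiv ℝ (natMap X f F (I.mu k)) (I.w k) h‖) {k : ℕ}
    (hk : merit X f F (I.mu k) (I.w k) ≠ 0) :
    ‖I.dTilde k‖ ≤ 2 * C * ‖natMap X f F (I.mu k) (I.w k)‖ := by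
  refine (hC k _).trans ?_
  rw [← hI.centering_newton k hk, mul_comm 2 C, mul_assoc]
  refine mul_le_mul_of_nonneg_left ((norm_add_le _ _).trans ?_) hC0
  rw [norm_neg]
  have := hI.centering_residual k hk
  nlinarith [norm_nonneg (natMap X f F (I.mu k) (I.w k)), (hP.θ₁_mem k).2]

lemma norm_dHat_le {C : ℝ} (hC0 : 0 ≤ C)
    (hC : ∀ k h, ‖h‖ ≤ C * ‖fderiv ℝ (natMap X f F (I.mu k)) (I.w k) h‖) (k : ℕ) :
    ‖I.dHat k‖ ≤ 2 * C * ‖natMap X f F 0 (I.w k)‖ := by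
  refine (hC k _).trans ?_
  rw [← hI.newton k, mul_comm 2 C, mul_assoc]
  refine mul_le_mul_of_nonneg_left ((norm_add_le _ _).trans ?_) hC0
  rw [norm_neg]
  have := hI.newton_residual k
  nlinarith [norm_nonneg (natMap X f F 0 (I.w k)), (hP.θ₂_mem k).2]

/-- If the natural map is well approximated by its linearization at the current iterate, a short
step along the inexact Newton direction decreases the merit function sufficiently. -/
lemma merit_step_le {A : WithLp 2 (E × E) →L[ℝ] WithLp 2 (E × E)} {C ε : ℝ} (hC0 : 0 ≤ C)
    (hC : ∀ k h, ‖h‖ ≤ C * ‖fderiv ℝ (natMap X f F (I.mu k)) (I.w k) h‖) (hε : 0 ≤ ε)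
    (hεC : 8 * ε * C ≤ 1 - P.σ - √2 * ⨆ k, P.θ₁ k)
    {k : ℕ} (hk : merit X f F (I.mu k) (I.w k) ≠ 0) {t : ℝ} (ht0 : 0 ≤ t) (ht1 : t ≤ 1)
    (hA : ‖fderiv ℝ (natMap X f F (I.mu k)) (I.w k) - A‖ ≤ ε)
    (hstep : ‖natMap X f F (I.mu k) (I.w k + t • I.dTilde k) - natMap X f F (I.mu k) (I.w k) -
      A (t • I.dTilde k)‖ ≤ ε * ‖t • I.dTilde k‖) :
    merit X f F (I.mu k) (I.w k + t • I.dTilde k) ≤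
      (1 - P.σ * t) * merit X f F (I.mu k) (I.w k) := by
  set H := natMap X f F (I.mu k) (I.w k) with hH
  set D := fderiv ℝ (natMap X f F (I.mu k)) (I.w k) with hD
  set d := I.dTilde k with hd
  set H' := natMap X f F (I.mu k) (I.w k + t • d) with hH'
  -- The Newton equation gives `H' = (1 - t) H + R`; `R` gathers the linearization error, the
  -- mismatch `D - A` and the residual.
  set R := (H' - H - A (t • d)) - (D - A) (t • d) + t • I.r₁ k with hR
  have hDd : D d = -H + I.r₁ k := (hI.centering_newton k hk).symm
  have hHR : H' = (1 - t) • H + R := by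
    have : (D - A) (t • d) = t • D d - A (t • d) := by simp [smul_sub]
    rw [hR, this, hDd]
    module
  have hd_le : ‖d‖ ≤ 2 * C * ‖H‖ := hI.norm_dTilde_le hP hC0 hC hk
  have htd : ‖t • d‖ ≤ t * (2 * C * ‖H‖) := by
    rw [norm_smul, Real.norm_of_nonneg ht0]
    exact mul_le_mul_of_nonneg_left hd_le ht0
  set θ := ⨆ k, P.θ₁ k with hθ
  have hr : ‖I.r₁ k‖ ≤ θ * ‖H‖ := (hI.centering_residual k hk).trans
    (mul_le_mul_of_nonneg_right (hP.θ₁_le k) (norm_nonneg _))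
  have hDA : ‖(D - A) (t • d)‖ ≤ ε * ‖t • d‖ :=
    ((D - A).le_opNorm _).trans (mul_le_mul_of_nonneg_right hA (norm_nonneg _))
  have hRle : ‖R‖ ≤ t * (4 * ε * C + θ) * ‖H‖ := by
    have h1 : ‖R‖ ≤ ε * ‖t • d‖ + ε * ‖t • d‖ + t * (θ * ‖H‖) := by
      refine (norm_add_le _ _).trans (add_le_add ((norm_sub_le _ _).trans
        (add_le_add hstep hDA)) ?_)
      rw [norm_smul, Real.norm_of_nonneg ht0]
      exact mul_le_mul_of_nonneg_left hr ht0
    have h2 := mul_le_mul_of_nonneg_left htd hε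
    linarith
  have hsqrt : √2 ≤ 2 := by
    rw [Real.sqrt_le_iff]; norm_num
  set M := merit X f F (I.mu k) (I.w k) with hM
  have hHM : ‖H‖ ≤ M := norm_natMap_le_merit _ _
  have hM0 : 0 ≤ M := merit_nonneg _ _
  have h3 : merit X f F (I.mu k) (I.w k + t • d) ≤ (1 - t) * M + √2 * ‖R‖ := by
    rw [merit_eq, ← hH', hHR]
    have h4 := norm_fst_add_norm_snd_le R
    have h5 : M = ‖H.snd‖ + ‖H.fst‖ := merit_eq _ _
    have h6 : ‖((1 - t) • H + R).snd‖ ≤ (1 - t) * ‖H.snd‖ + ‖R.snd‖ := by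
      rw [WithLp.add_snd, WithLp.smul_snd]
      refine (norm_add_le _ _).trans_eq ?_
      rw [norm_smul, Real.norm_of_nonneg (by linarith)]
    have h7 : ‖((1 - t) • H + R).fst‖ ≤ (1 - t) * ‖H.fst‖ + ‖R.fst‖ := by
      rw [WithLp.add_fst, WithLp.smul_fst]
      refine (norm_add_le _ _).trans_eq ?_
      rw [norm_smul, Real.norm_of_nonneg (by linarith)]
    rw [h5]
    linarith
  have h8 : √2 * ‖R‖ ≤ t * (1 - P.σ) * M := by
    -- The `8` in `hεC` is `2 * 4`, with `√2` bounded by `2`; the factor `√2` before `θ` is kept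
    -- exact to match the parameter condition.
    have h9 : √2 * (4 * ε * C + θ) ≤ 1 - P.σ := by
      have := mul_le_mul_of_nonneg_right hsqrt (by positivity : 0 ≤ 4 * ε * C)
      linarith
    calc √2 * ‖R‖ ≤ √2 * (t * (4 * ε * C + θ) * ‖H‖) := by gcongr
      _ = t * (√2 * (4 * ε * C + θ)) * ‖H‖ := by ring
      _ ≤ t * (1 - P.σ) * M := by
        gcongr
        exact mul_nonneg ht0 (by linarith [hP.σ_mem.2])
  linarith

variable [FiniteDimensional ℝ E]
  (hf : IsSelfConcordantBarrier X f ϑ) (hX : Convex ℝ X) (hXc : IsClosed X)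
  (hXi : (interior X).Nonempty) (hF : ContDiff ℝ 1 F)
  (hN : UniformlyNonsingular X f F I) {wstar : WithLp 2 (E × E)}
  (hw : MapClusterPt wstar atTop I.w)
include hf hX hXc hXi hF hN hw

/-- Near a cluster point, while the smoothing parameters stay away from zero, the centering steps
have step lengths bounded away from zero. -/
lemma exists_frequently_merit_wTilde_le {μ : ℝ} (hμ : 0 < μ) (hlim : Tendsto I.mu atTop (𝓝 μ)) :
    ∃ t > 0, ∃ᶠ k in atTop,
      merit X f F (I.mu k) (I.wTilde (k + 1)) ≤ (1 - P.σ * t) * (P.β * I.mu k) := by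
  obtain ⟨C, hCpos, hC⟩ := hN.exists_norm_le
  set κ := 1 - P.σ - √2 * ⨆ k, P.θ₁ k with hκ
  have hκpos : 0 < κ := by linarith [hP.θ₁_sup]
  set ε := κ / (8 * C) with hε
  have hεpos : 0 < ε := by positivity
  have hl : ∀ᶠ ν in 𝓝 μ, ν ≠ 0 := by
    filter_upwards [lt_mem_nhds hμ] with ν hν using hν.ne'
  obtain ⟨δ, hδ, hball⟩ := exists_ball_linearization (g := natMap X f F)
    (hl.mono fun ν hν u => (hf.hasFDerivAt_natMap_of_ne_zero hX hXc hXi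
      (hF.differentiable (by norm_num)) hν u).differentiableAt)
    (hf.tendsto_fderiv_natMap hX hXc hXi hF hl
      (hf.tendsto_fderiv_smoothing_of_pos hX hXc hXi hμ (wstar.fst - wstar.snd))) hεpos
  set B := 2 * C * (P.β * I.mu 0) with hB
  have hβ := hP.β_pos
  have hμ0 := hI.mu_zero_pos
  have hBpos : 0 < B := by positivity
  -- `B` bounds every Newton direction used, so the trial step `α₁ ^ j` moves less than `δ / 2` and
  -- stays in the linearization ball. This `j` does not depend on `k`.
  obtain ⟨j, hj⟩ := exists_pow_lt_of_lt_one (by positivity : 0 < δ / 2 / B) hP.α₁_mem.2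
  have ht0 : 0 < P.α₁ ^ j := pow_pos hP.α₁_mem.1 j
  have ht1 : P.α₁ ^ j ≤ 1 := pow_le_one₀ hP.α₁_mem.1.le hP.α₁_mem.2.le
  set t := P.α₁ ^ j with ht
  refine ⟨t, ht0, ?_⟩
  have hnear := mapClusterPt_iff_frequently.1 hw _ (Metric.ball_mem_nhds wstar (half_pos hδ))
  refine (hnear.and_eventually (hlim.eventually hball)).mono fun k hk => ?_
  obtain ⟨hk, hlin⟩ := hk
  have hβμ := hI.merit_le hP k
  have hσ := hP.σ_mem
  have hσt : 0 ≤ 1 - P.σ * t := by nlinarith [hσ.1, hσ.2]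
  by_cases hz : merit X f F (I.mu k) (I.w k) = 0
  · rw [hI.centering_trivial k hz, hz]
    have := hI.mu_pos hP k
    positivity
  · have hls := hI.line_search k hz
    have hkδ : I.w k ∈ Metric.ball wstar δ := Metric.ball_subset_ball (by linarith) hk
    have hd : ‖I.dTilde k‖ ≤ B := by
      refine (hI.norm_dTilde_le hP hCpos.le hC hz).trans ?_
      have h1 : ‖natMap X f F (I.mu k) (I.w k)‖ ≤ P.β * I.mu 0 :=
        (norm_natMap_le_merit _ _).trans (hβμ.trans
          (mul_le_mul_of_nonneg_left (hI.antitone_mu hP (Nat.zero_le k)) hβ.le))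
      exact mul_le_mul_of_nonneg_left h1 (by positivity)
    have hmem : I.w k + t • I.dTilde k ∈ Metric.ball wstar δ := by
      rw [mem_ball_iff_norm] at hk ⊢
      have h2 : ‖t • I.dTilde k‖ < δ / 2 := by
        rw [norm_smul, Real.norm_of_nonneg ht0.le]
        rw [lt_div_iff₀ hBpos] at hj
        exact (mul_le_mul_of_nonneg_left hd ht0.le).trans_lt hj
      calc ‖I.w k + t • I.dTilde k - wstar‖ = ‖(I.w k - wstar) + t • I.dTilde k‖ := by
            congr 1; abel
        _ ≤ ‖I.w k - wstar‖ + ‖t • I.dTilde k‖ := norm_add_le _ _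
        _ < δ := by linarith
    have hdec := hI.merit_step_le hP hCpos.le hC hεpos.le
      (by rw [hε, ← hκ]; exact le_of_eq (by field_simp)) hz ht0.le ht1 (hlin _ hkδ).1 (by
        have := (hlin _ hmem).2 _ hkδ
        rwa [add_sub_cancel_left] at this)
    have hlam : t ≤ I.lam k := hls.2 ⟨⟨j, rfl⟩, hdec⟩
    rw [hI.wTilde_eq k hz]
    refine hls.1.2.trans (mul_le_mul ?_ hβμ (merit_nonneg _ _) hσt)
    have := mul_le_mul_of_nonneg_left hlam hσ.1.le
    linarith

lemma tendsto_mu : Tendsto I.mu atTop (𝓝[>] 0) := by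
  refine tendsto_nhdsWithin_iff.2 ⟨?_, Eventually.of_forall fun k => hI.mu_pos hP k⟩
  have hbdd : BddBelow (Set.range I.mu) :=
    ⟨0, by rintro _ ⟨k, rfl⟩; exact (hI.mu_pos hP k).le⟩
  have hlim := tendsto_atTop_ciInf (hI.antitone_mu hP) hbdd
  set μ := ⨅ k, I.mu k with hμ
  have hμ0 : 0 ≤ μ := le_ciInf fun k => (hI.mu_pos hP k).le
  rcases hμ0.eq_or_lt with h0 | h0
  · rwa [← h0] at hlim
  exfalso
  obtain ⟨t, ht, hfreq⟩ :=
    hI.exists_frequently_merit_wTilde_le hP hf hX hXc hXi hF hN hw h0 hlim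
  have hβ := hP.β_pos
  have hσ := hP.σ_mem.1
  -- Replacing `μ` by `(1 - γ) μ` costs at most `√(ϑ (1 - (1 - γ)²)) μ` in merit and `β γ μ` in the
  -- threshold; for small `γ` the gain `β σ t μ` of the centering step covers both.
  have hsmall : ∀ᶠ j : ℕ in atTop, √(ϑ * (1 - (1 - P.α₂ ^ j) ^ 2)) + P.β * P.α₂ ^ j <
      P.β * (P.σ * t) := by
    have hc : Continuous fun γ : ℝ => √(ϑ * (1 - (1 - γ) ^ 2)) + P.β * γ := by fun_prop
    have h1 := (hc.tendsto 0).comp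
      (tendsto_pow_atTop_nhds_zero_of_lt_one hP.α₂_mem.1.le hP.α₂_mem.2)
    refine h1.eventually (gt_mem_nhds ?_)
    simp only [sub_zero, one_pow, sub_self, mul_zero, Real.sqrt_zero, add_zero]
    positivity
  obtain ⟨j, hj⟩ := hsmall.exists
  have hγ0 : 0 < P.α₂ ^ j := pow_pos hP.α₂_mem.1 j
  have hγ1 : P.α₂ ^ j ≤ 1 := pow_le_one₀ hP.α₂_mem.1.le hP.α₂_mem.2.le
  set γ := P.α₂ ^ j with hγ
  have hle : ∃ᶠ k in atTop, I.mu (k + 1) ≤ (1 - γ) * I.mu k := by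
    refine hfreq.mono fun k hk => ?_
    have hmk := hI.mu_pos hP k
    have hgam : γ ≤ I.gam k := by
      refine (hI.gam_greatest k).2 ⟨⟨j, rfl⟩, ?_⟩
      have h2 := hf.merit_le_merit_add_sqrt (F := F) hX hXc hXi
        (mul_nonneg (sub_nonneg.2 hγ1) hmk.le)
        (mul_le_of_le_one_left hmk.le (by linarith : 1 - γ ≤ 1)) (I.wTilde (k + 1))
      have h3 : √(ϑ * (I.mu k ^ 2 - ((1 - γ) * I.mu k) ^ 2)) =
          √(ϑ * (1 - (1 - γ) ^ 2)) * I.mu k := by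
        rw [show ϑ * (I.mu k ^ 2 - ((1 - γ) * I.mu k) ^ 2) =
          ϑ * (1 - (1 - γ) ^ 2) * I.mu k ^ 2 by ring,
          Real.sqrt_mul' _ (sq_nonneg _), Real.sqrt_sq hmk.le]
      rw [h3] at h2
      have h4 := mul_le_mul_of_nonneg_right hj.le hmk.le
      change merit X f F _ _ ≤ _
      nlinarith
    refine (hI.mu_succ_le_muTilde hP k).trans ?_
    rw [hI.muTilde_eq]
    exact mul_le_mul_of_nonneg_right (by linarith) hmk.le
  -- Both sides converge, to `(1 - γ) μ` and `μ`.
  have hlt : ∀ᶠ k in atTop, (1 - γ) * I.mu k < I.mu (k + 1) :=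
    (hlim.const_mul (1 - γ)).eventually_lt (hlim.comp (tendsto_add_atTop_nat 1)) (by nlinarith)
  exact hle (hlt.mono fun k hk => not_le.2 hk)

end IsInfiniteRun

end Run

/-! ### Contraction and acceptance of the approximate Newton step. -/

section LocalConvergence

variable {E : Type*} [NormedAddCommGroup E] [InnerProductSpace ℝ E] [CompleteSpace E]
  [FiniteDimensional ℝ E]
  {X : Set E} {f : E → ℝ} {F : E → E} {ϑ : ℝ} {P : Params} {I : Iterates E}

lemma IsSelfConcordantBarrier.exists_ball_norm_natMap_sub_le
    (hf : IsSelfConcordantBarrier X f ϑ) (hX : Convex ℝ X) (hXc : IsClosed X)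
    (hXi : (interior X).Nonempty) (hF : ContDiff ℝ 1 F) {w : WithLp 2 (E × E)} {T : E →L[ℝ] E}
    (hT : Tendsto (fun q : E × ℝ => fderiv ℝ (smoothing X f q.2) q.1)
      (𝓝 (w.fst - w.snd) ×ˢ 𝓝[>] (0 : ℝ)) (𝓝 T)) :
    ∃ M > 0, ∃ δ > 0, ∀ u ∈ Metric.ball w δ,
      ‖natMap X f F 0 u - natMap X f F 0 w‖ ≤ M * ‖u - w‖ := by
  obtain ⟨δ, hδ, -, h⟩ := hf.exists_ball_natMap_linearization hX hXc hXi hF hT one_pos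
  set A := natMapDeriv T (fderiv ℝ F w.fst)
  refine ⟨1 + ‖A‖, by positivity, δ, hδ, fun u hu => ?_⟩
  have h1 := h u hu w (Metric.mem_ball_self hδ)
  have h2 := A.le_opNorm (u - w)
  have h3 := norm_sub_norm_le (natMap X f F 0 u - natMap X f F 0 w) (A (u - w))
  linarith

namespace IsInfiniteRun

variable (hI : IsInfiniteRun X f F P I) (hP : P.Valid ϑ)
  (hf : IsSelfConcordantBarrier X f ϑ) (hX : Convex ℝ X) (hXc : IsClosed X)
  (hXi : (interior X).Nonempty)

section

include hI hP hf hX hXc hXi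

lemma norm_natMap_zero_le (k : ℕ) :
    ‖natMap X f F 0 (I.w k)‖ ≤ (P.β + √ϑ) * I.mu k := by
  have h1 := hf.merit_zero_le (F := F) hX hXc hXi (hI.mu_pos hP k).le (I.w k)
  have h2 := hI.merit_le hP k
  have h3 := norm_natMap_le_merit (X := X) (f := f) (F := F) 0 (I.w k)
  linarith

end

omit [FiniteDimensional ℝ E] in
include hI in
lemma fderiv_natMap_wHat_sub (w : WithLp 2 (E × E)) (k : ℕ) :
    fderiv ℝ (natMap X f F (I.mu k)) (I.w k) (I.wHat (k + 1) - w) =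
      fderiv ℝ (natMap X f F (I.mu k)) (I.w k) (I.w k - w) - natMap X f F 0 (I.w k) + I.r₂ k := by
  rw [hI.wHat_eq, show I.w k + I.dHat k - w = (I.w k - w) + I.dHat k by abel, map_add,
    ← hI.newton k]
  abel

variable (hF : ContDiff ℝ 1 F)
  (hN : UniformlyNonsingular X f F I) {wstar : WithLp 2 (E × E)}
  (hw : MapClusterPt wstar atTop I.w) {T : E →L[ℝ] E}
  (hT : Tendsto (fun q : E × ℝ => fderiv ℝ (smoothing X f q.2) q.1)
      (𝓝 (wstar.fst - wstar.snd) ×ˢ 𝓝[>] (0 : ℝ)) (𝓝 T))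
include hI hP hf hX hXc hXi hF hN hw hT

/-- `H_0(w_k)` is `O(μ_k)`, hence tends to zero, and `H_0` is continuous at the cluster point. -/
lemma natMap_eq_zero_of_mapClusterPt : natMap X f F 0 wstar = 0 := by
  obtain ⟨M, hM, δ, hδ, hball⟩ := hf.exists_ball_norm_natMap_sub_le hX hXc hXi hF hT
  by_contra hne
  have hc : 0 < ‖natMap X f F 0 wstar‖ := norm_pos_iff.2 hne
  set c := ‖natMap X f F 0 wstar‖
  have hmu : Tendsto (fun k => (P.β + √ϑ) * I.mu k) atTop (𝓝 ((P.β + √ϑ) * 0)) :=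
    ((hI.tendsto_mu hP hf hX hXc hXi hF hN hw).mono_right nhdsWithin_le_nhds).const_mul _
  rw [mul_zero] at hmu
  have h1 := hmu.eventually (gt_mem_nhds (half_pos hc))
  have h2 := mapClusterPt_iff_frequently.1 hw _
    (Metric.ball_mem_nhds wstar (lt_min hδ (by positivity : 0 < c / 2 / M)))
  obtain ⟨k, hk, hk'⟩ := (h2.and_eventually h1).exists
  rw [mem_ball_iff_norm, lt_min_iff] at hk
  have h3 := hball (I.w k) (mem_ball_iff_norm.2 hk.1)
  have h4 := hk.2
  rw [lt_div_iff₀ hM] at h4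
  have h5 := hI.norm_natMap_zero_le hP hf hX hXc hXi k
  have h6 := norm_sub_norm_le (natMap X f F 0 wstar) (natMap X f F 0 (I.w k))
  rw [norm_sub_rev] at h6
  change c - _ ≤ _ at h6
  linarith

variable (hr₂ : I.r₂ =o[atTop] fun k => natMap X f F 0 (I.w k))
include hr₂

/-- The approximate Newton step contracts the distance to the cluster point by any given factor,
close to that point. -/
lemma exists_ball_norm_wHat_sub_le {ε : ℝ} (hε : 0 < ε) :
    ∃ δ > 0, ∀ᶠ k in atTop, I.w k ∈ Metric.ball wstar δ →
      ‖I.wHat (k + 1) - wstar‖ ≤ ε * ‖I.w k - wstar‖ := by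
  obtain ⟨C, hC0, hC⟩ := hN.exists_norm_le
  obtain ⟨M, hM, δ₁, hδ₁, hLip⟩ := hf.exists_ball_norm_natMap_sub_le hX hXc hXi hF hT
  obtain ⟨δ₂, hδ₂, hder, hlin⟩ := hf.exists_ball_natMap_linearization hX hXc hXi hF hT
    (by positivity : 0 < ε / (3 * C))
  have hz := hI.natMap_eq_zero_of_mapClusterPt hP hf hX hXc hXi hF hN hw hT
  refine ⟨min δ₁ δ₂, lt_min hδ₁ hδ₂, ?_⟩
  filter_upwards [(hI.tendsto_mu hP hf hX hXc hXi hF hN hw).eventually hder,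
    hr₂.bound (by positivity : 0 < ε / (3 * C) / M)] with k hk hrk hball
  have hb₁ := Metric.ball_subset_ball (min_le_left _ _) hball
  have hb₂ := Metric.ball_subset_ball (min_le_right _ _) hball
  have h1 := hC k (I.wHat (k + 1) - wstar)
  rw [hI.fderiv_natMap_wHat_sub] at h1
  have h2 := hLip _ hb₁
  have h3 := hk _ hb₂
  have h4 := hlin _ hb₂ _ (Metric.mem_ball_self hδ₂)
  rw [hz, sub_zero] at h2 h4
  set D := fderiv ℝ (natMap X f F (I.mu k)) (I.w k)
  set A := natMapDeriv T (fderiv ℝ F wstar.fst)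
  set v := I.w k - wstar
  set H := natMap X f F 0 (I.w k)
  have h5 : ‖(D - A) v‖ ≤ ε / (3 * C) * ‖v‖ :=
    ((D - A).le_opNorm v).trans (mul_le_mul_of_nonneg_right h3 (norm_nonneg _))
  have h6 : ‖I.r₂ k‖ ≤ ε / (3 * C) * ‖v‖ := by
    refine hrk.trans ?_
    calc ε / (3 * C) / M * ‖H‖ ≤ ε / (3 * C) / M * (M * ‖v‖) :=
          mul_le_mul_of_nonneg_left h2 (by positivity)
      _ = ε / (3 * C) * ‖v‖ := by field_simp
  -- Three errors share the budget: derivative mismatch, linearization of `H_0` at its zero, and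
  -- residual.
  have h7 : ‖D v - H + I.r₂ k‖ ≤ 3 * (ε / (3 * C) * ‖v‖) := by
    have : D v - H + I.r₂ k = (D - A) v - (H - A v) + I.r₂ k := by
      rw [sub_apply]; abel
    rw [this]
    have := norm_add_le ((D - A) v - (H - A v)) (I.r₂ k)
    have := norm_sub_le ((D - A) v) (H - A v)
    linarith
  calc ‖I.wHat (k + 1) - wstar‖ ≤ C * (3 * (ε / (3 * C) * ‖v‖)) :=
        h1.trans (mul_le_mul_of_nonneg_left h7 hC0.le)
    _ = ε * ‖v‖ := by field_simp

/-- The approximate Newton step is taken close to the cluster point. -/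
lemma exists_ball_wHat_mem_nbhd :
    ∃ δ > 0, ∀ᶠ k in atTop, I.w k ∈ Metric.ball wstar δ →
      I.wHat (k + 1) ∈ nbhd X f F P.β (I.muTilde (k + 1)) := by
  obtain ⟨C, hC0, hC⟩ := hN.exists_norm_le
  obtain ⟨M, hM, δ₁, hδ₁, hLip⟩ := hf.exists_ball_norm_natMap_sub_le hX hXc hXi hF hT
  have hz := hI.natMap_eq_zero_of_mapClusterPt hP hf hX hXc hXi hF hN hw hT
  have hβ := hP.β_pos
  have hβϑ : 0 < P.β - √ϑ := sub_pos.2 hP.β_gt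
  have hα : 0 < 1 - P.α₂ := sub_pos.2 hP.α₂_mem.2
  set K := 2 * M * (4 * C * (P.β + √ϑ)) with hK
  have hKpos : 0 < K := by positivity
  set ε := (P.β - √ϑ) * (1 - P.α₂) / K with hε
  have hεpos : 0 < ε := by positivity
  obtain ⟨δ₂, hδ₂, hcon⟩ := hI.exists_ball_norm_wHat_sub_le hP hf hX hXc hXi hF hN hw hT hr₂
    (lt_min hεpos one_half_pos)
  refine ⟨min δ₁ δ₂, lt_min hδ₁ hδ₂, ?_⟩
  filter_upwards [hcon] with k hk hball
  have hb₁ := Metric.ball_subset_ball (min_le_left _ _) hball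
  have hb₂ := Metric.ball_subset_ball (min_le_right _ _) hball
  have h1 := hk hb₂
  have h0 : 0 ≤ ‖I.w k - wstar‖ := norm_nonneg _
  have h2 : ‖I.wHat (k + 1) - wstar‖ ≤ ε * ‖I.w k - wstar‖ :=
    h1.trans (mul_le_mul_of_nonneg_right (min_le_left _ _) h0)
  have h3 : ‖I.wHat (k + 1) - wstar‖ ≤ 1 / 2 * ‖I.w k - wstar‖ :=
    h1.trans (mul_le_mul_of_nonneg_right (min_le_right _ _) h0)
  -- Contraction by `1/2` gives `‖w_k - w*‖ ≤ 2 ‖ŵ - w_k‖`, and the Newton direction is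
  -- `O(‖H_0(w_k)‖) = O(μ_k)`.
  have h4 : ‖I.w k - wstar‖ ≤ 4 * C * (P.β + √ϑ) * I.mu k := by
    have h5 := (hI.norm_dHat_le hP hC0.le hC k).trans
      (mul_le_mul_of_nonneg_left (hI.norm_natMap_zero_le hP hf hX hXc hXi k) (by positivity))
    have h6 : ‖I.w k - wstar‖ ≤ ‖I.wHat (k + 1) - wstar‖ + ‖I.dHat k‖ := by
      rw [show I.w k - wstar = (I.wHat (k + 1) - wstar) - I.dHat k by rw [hI.wHat_eq]; abel]
      exact norm_sub_le _ _
    linarith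
  have h7 : I.wHat (k + 1) ∈ Metric.ball wstar δ₁ := by
    rw [mem_ball_iff_norm] at hb₁ ⊢
    linarith
  have h8 := hLip _ h7
  rw [hz, sub_zero] at h8
  have h9 := NonInterior.merit_le (X := X) (f := f) (F := F) 0 (I.wHat (k + 1))
  have hsqrt : √2 ≤ 2 := by
    rw [Real.sqrt_le_iff]; norm_num
  have hmt := hI.muTilde_pos hP k
  have h10 : merit X f F 0 (I.wHat (k + 1)) ≤ (P.β - √ϑ) * I.muTilde (k + 1) := by
    calc merit X f F 0 (I.wHat (k + 1)) ≤ √2 * ‖natMap X f F 0 (I.wHat (k + 1))‖ := h9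
      _ ≤ 2 * (M * (ε * (4 * C * (P.β + √ϑ) * I.mu k))) := by
        refine mul_le_mul hsqrt (h8.trans ?_) (norm_nonneg _) zero_le_two
        exact mul_le_mul_of_nonneg_left (h2.trans (mul_le_mul_of_nonneg_left h4 hεpos.le)) hM.le
      _ = K * ε * I.mu k := by rw [hK]; ring
      _ = (P.β - √ϑ) * ((1 - P.α₂) * I.mu k) := by rw [hε]; field_simp
      _ ≤ (P.β - √ϑ) * I.muTilde (k + 1) :=
        mul_le_mul_of_nonneg_left (hI.le_muTilde hP k) hβϑ.le
  -- Passing from `Ψ_0` to `Ψ_μ̃` costs `√ϑ μ̃`, exactly what the bound `(β - √ϑ) μ̃` leaves free.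
  have h11 := hf.merit_le_merit_zero_add (F := F) hX hXc hXi hmt.le (I.wHat (k + 1))
  change merit X f F _ _ ≤ _
  linarith

/-- The sequence enters the ball at some late index because `w*` is a cluster point; from there
acceptance and contraction by `1/2` sustain each other. -/
lemma tendsto_w : Tendsto I.w atTop (𝓝 wstar) ∧ ∀ᶠ k in atTop,
    I.wHat (k + 1) ∈ nbhd X f F P.β (I.muTilde (k + 1)) := by
  obtain ⟨δ₁, hδ₁, hcon⟩ := hI.exists_ball_norm_wHat_sub_le hP hf hX hXc hXi hF hN hw hT hr₂
    one_half_pos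
  obtain ⟨δ₂, hδ₂, hacc⟩ := hI.exists_ball_wHat_mem_nbhd hP hf hX hXc hXi hF hN hw hT hr₂
  obtain ⟨K, hK⟩ := eventually_atTop.1 (hcon.and hacc)
  obtain ⟨k₀, hk₀, hkK⟩ := ((mapClusterPt_iff_frequently.1 hw _
    (Metric.ball_mem_nhds wstar (lt_min hδ₁ hδ₂))).and_eventually
      (eventually_ge_atTop K)).exists
  have hstep : ∀ k ≥ K, I.w k ∈ Metric.ball wstar (min δ₁ δ₂) →
      I.wHat (k + 1) ∈ nbhd X f F P.β (I.muTilde (k + 1)) ∧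
        ‖I.w (k + 1) - wstar‖ ≤ 1 / 2 * ‖I.w k - wstar‖ := fun k hk hb => by
    have h1 := (hK k hk).2 (Metric.ball_subset_ball (min_le_right _ _) hb)
    refine ⟨h1, ?_⟩
    rw [(hI.accepted k h1).2.2.2]
    exact (hK k hk).1 (Metric.ball_subset_ball (min_le_left _ _) hb)
  have hind : ∀ n, I.w (n + k₀) ∈ Metric.ball wstar (min δ₁ δ₂) ∧
      ‖I.w (n + k₀) - wstar‖ ≤ (1 / 2) ^ n * ‖I.w k₀ - wstar‖ := fun n => by
    induction n with
    | zero => simpa using hk₀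
    | succ n ih =>
      have h1 := (hstep (n + k₀) (by omega) ih.1).2
      rw [show n + 1 + k₀ = n + k₀ + 1 by omega]
      refine ⟨?_, ?_⟩
      · have h2 := ih.1
        rw [mem_ball_iff_norm] at h2 ⊢
        linarith [norm_nonneg (I.w (n + k₀) - wstar)]
      · rw [pow_succ]
        linarith [ih.2]
  constructor
  · rw [← tendsto_add_atTop_iff_nat k₀, tendsto_iff_norm_sub_tendsto_zero]
    refine squeeze_zero (fun _ => norm_nonneg _) (fun n => (hind n).2) ?_
    simpa using (tendsto_pow_atTop_nhds_zero_of_lt_one (by norm_num : (0 : ℝ) ≤ 1 / 2)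
      (by norm_num)).mul_const ‖I.w k₀ - wstar‖
  · rw [eventually_atTop]
    refine ⟨k₀, fun k hk => ?_⟩
    obtain ⟨n, rfl⟩ := Nat.exists_eq_add_of_le' hk
    exact (hstep _ (by omega) (hind n).1).1

lemma isLittleO_w_succ_sub : (fun k => I.w (k + 1) - wstar) =o[atTop] (fun k => I.w k - wstar) := by
  obtain ⟨hlim, hacc⟩ := hI.tendsto_w hP hf hX hXc hXi hF hN hw hT hr₂
  refine isLittleO_iff.2 fun ε hε => ?_
  obtain ⟨δ, hδ, hcon⟩ := hI.exists_ball_norm_wHat_sub_le hP hf hX hXc hXi hF hN hw hT hr₂ hε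
  filter_upwards [hacc, hcon, hlim.eventually (Metric.ball_mem_nhds wstar hδ)] with k h1 h2 h3
  rw [(hI.accepted k h1).2.2.2]
  exact h2 h3

/-- Eventually the smoothing parameter is bounded by a multiple of the distance to the limit. -/
lemma exists_eventually_mu_le :
    ∃ M > 0, ∀ᶠ k in atTop, I.mu k ≤ M * ‖I.w k - wstar‖ := by
  obtain ⟨hlim, hacc⟩ := hI.tendsto_w hP hf hX hXc hXi hF hN hw hT hr₂
  obtain ⟨M, hM, δ, hδ, hLip⟩ := hf.exists_ball_norm_natMap_sub_le hX hXc hXi hF hT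
  have hz := hI.natMap_eq_zero_of_mapClusterPt hP hf hX hXc hXi hF hN hw hT
  have hβϑ : 0 < P.β - √ϑ := sub_pos.2 hP.β_gt
  have hα := hP.α₃_mem.1
  set c := (P.β - √ϑ) * P.α₃ with hc
  have hcpos : 0 < c := by positivity
  refine ⟨√2 * M / c, by positivity, ?_⟩
  have hsucc : ∀ᶠ k in atTop, I.mu (k + 1) ≤ √2 * M / c * ‖I.w (k + 1) - wstar‖ := by
    filter_upwards [hacc, (hlim.comp (tendsto_add_atTop_nat 1)).eventually
      (Metric.ball_mem_nhds wstar hδ)] with k h1 h2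
    obtain ⟨-, ⟨⟨-, hnot⟩, -⟩, hmu, hwk⟩ := hI.accepted k h1
    have h3 := hLip _ h2
    rw [hz, sub_zero] at h3
    simp only [Function.comp_apply] at h3
    -- Admissibility of `η_k` puts the new iterate outside the neighbourhood at `α₃ μ_{k+1}`. So its
    -- merit is bounded below by a multiple of `μ_{k+1}`, while it is `O(‖w_{k+1} - w*‖)` up to the
    -- smoothing error `√ϑ α₃ μ_{k+1}`.
    have h4 : I.eta k * P.α₃ * I.muTilde (k + 1) = P.α₃ * I.mu (k + 1) := by rw [hmu]; ring
    rw [h4, ← hwk] at hnot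
    have h5 : P.β * (P.α₃ * I.mu (k + 1)) < merit X f F (P.α₃ * I.mu (k + 1)) (I.w (k + 1)) :=
      not_le.1 hnot
    have h6 := hf.merit_le_merit_zero_add (F := F) hX hXc hXi
      (mul_pos hα (hI.mu_pos hP (k + 1))).le (I.w (k + 1))
    have h7 := NonInterior.merit_le (X := X) (f := f) (F := F) 0 (I.w (k + 1))
    have h8 := mul_le_mul_of_nonneg_left h3 (Real.sqrt_nonneg 2)
    rw [div_mul_eq_mul_div, le_div_iff₀ hcpos, hc]
    linarith
  obtain ⟨K, hK⟩ := eventually_atTop.1 hsucc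
  refine eventually_atTop.2 ⟨K + 1, fun k hk => ?_⟩
  obtain ⟨n, rfl⟩ := Nat.exists_eq_add_of_le' (by omega : 1 ≤ k)
  exact hK n (by omega)

end IsInfiniteRun

end LocalConvergence

/-! ### Convergence of order `ξ`. -/

section Rate

variable {E : Type*} [NormedAddCommGroup E] [InnerProductSpace ℝ E] [CompleteSpace E]
  [FiniteDimensional ℝ E]
  {X : Set E} {f : E → ℝ} {F : E → E} {ϑ : ℝ} {P : Params} {I : Iterates E}

lemma IsSelfConcordantBarrier.norm_proj_linearization_le
    (hf : IsSelfConcordantBarrier X f ϑ) (hX : Convex ℝ X) (hXc : IsClosed X)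
    (hXi : (interior X).Nonempty) {z₀ : E} {T : E →L[ℝ] E} {ξ M : ℝ} (hξ : 1 < ξ) (hM : 0 ≤ M)
    (h : ∀ᶠ q : E × ℝ in 𝓝 z₀ ×ˢ 𝓝[>] (0 : ℝ),
      ‖fderiv ℝ (smoothing X f q.2) q.1 - T‖ ≤ M * (‖q.1 - z₀‖ + |q.2|) ^ (ξ - 1)) :
    ∀ᶠ z in 𝓝 z₀, ‖smoothing X f 0 z - smoothing X f 0 z₀ - T (z - z₀)‖ ≤ M * ‖z - z₀‖ ^ ξ := by
  obtain ⟨p, hp, q, hq, hpq⟩ := eventually_prod_iff.1 h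
  obtain ⟨δ, hδ, hball⟩ := Metric.eventually_nhds_iff_ball.1 hp
  filter_upwards [Metric.ball_mem_nhds z₀ hδ] with z hz
  set r := ‖z - z₀‖ with hr
  have hr0 : 0 ≤ r := norm_nonneg _
  have hbound : ∀ᶠ μ in 𝓝[>] (0 : ℝ),
      ‖smoothing X f μ z - smoothing X f μ z₀ - T (z - z₀)‖ ≤ M * (r + |μ|) ^ (ξ - 1) * r := by
    filter_upwards [hq, self_mem_nhdsWithin] with μ hμ hμ0
    have hμ0' : (0 : ℝ) < μ := hμ0
    -- The open ball makes the derivative bound available, and the closed ball of radius `r = ‖z -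
    -- z₀‖` turns it into one in terms of `r`. Letting `μ → 0` afterwards leaves `M * r ^ ξ`.
    refine Convex.norm_image_sub_le_of_norm_fderiv_le' (𝕜 := ℝ)
      (s := Metric.ball z₀ δ ∩ Metric.closedBall z₀ r)
      (fun x _ => (hf.hasFDerivAt_smoothing hX hXc hXi hμ0'.ne' x).differentiableAt)
      (fun x hx => (hpq (hball x hx.1) hμ).trans ?_)
      ((convex_ball z₀ δ).inter (convex_closedBall z₀ r))
      ⟨Metric.mem_ball_self hδ, Metric.mem_closedBall_self hr0⟩
      ⟨hz, mem_closedBall_iff_norm.2 le_rfl⟩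
    have hx' : ‖x - z₀‖ ≤ r := mem_closedBall_iff_norm.1 hx.2
    refine mul_le_mul_of_nonneg_left (Real.rpow_le_rpow (by positivity) ?_ (by linarith)) hM
    exact add_le_add_left hx' _
  have hc : Continuous fun μ : ℝ => M * (r + |μ|) ^ (ξ - 1) * r := by
    refine (continuous_const.mul (Continuous.rpow_const (by fun_prop) fun _ => ?_)).mul
      continuous_const
    exact Or.inr (by linarith)
  have hlim : Tendsto (fun μ : ℝ => M * (r + |μ|) ^ (ξ - 1) * r) (𝓝[>] 0) (𝓝 (M * r ^ ξ)) := by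
    have h1 := (hc.tendsto 0).mono_left (nhdsWithin_le_nhds (s := Set.Ioi 0))
    rwa [abs_zero, add_zero, mul_assoc, ← Real.rpow_add_one' hr0 (by linarith),
      sub_add_cancel] at h1
  exact le_of_tendsto_of_tendsto ((((hf.tendsto_smoothing_nhdsGT_zero hX hXc hXi z).sub
    (hf.tendsto_smoothing_nhdsGT_zero hX hXc hXi z₀)).sub_const _).norm) hlim hbound

namespace IsInfiniteRun

lemma isBigO_w_succ_sub (hI : IsInfiniteRun X f F P I) (hP : P.Valid ϑ)
    (hf : IsSelfConcordantBarrier X f ϑ) (hX : Convex ℝ X) (hXc : IsClosed X)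
    (hXi : (interior X).Nonempty) (hF : ContDiff ℝ 1 F)
    (hN : UniformlyNonsingular X f F I) {wstar : WithLp 2 (E × E)}
    (hw : MapClusterPt wstar atTop I.w) {T : E →L[ℝ] E}
    (hT : Tendsto (fun q : E × ℝ => fderiv ℝ (smoothing X f q.2) q.1)
      (𝓝 (wstar.fst - wstar.snd) ×ˢ 𝓝[>] (0 : ℝ)) (𝓝 T))
    (hr₂ : I.r₂ =o[atTop] fun k => natMap X f F 0 (I.w k)) {ξ : ℝ} (hξ : 1 < ξ)
    (hL : LinearizationOrder F ξ)
    (hTξ : (fun q : E × ℝ => fderiv ℝ (smoothing X f q.2) q.1 - T)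
      =O[𝓝 (wstar.fst - wstar.snd) ×ˢ 𝓝[>] (0 : ℝ)]
      (fun q : E × ℝ => ‖WithLp.toLp 2 (q.1 - (wstar.fst - wstar.snd), q.2)‖ ^ (ξ - 1)))
    (hrξ : I.r₂ =O[atTop] (fun k => ‖natMap X f F 0 (I.w k)‖ ^ ξ)) :
    (fun k => I.w (k + 1) - wstar) =O[atTop] (fun k => ‖I.w k - wstar‖ ^ ξ) := by
  obtain ⟨hlim, hacc⟩ := hI.tendsto_w hP hf hX hXc hXi hF hN hw hT hr₂
  obtain ⟨C, hC0, hC⟩ := hN.exists_norm_le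
  obtain ⟨N, hN0, hmu⟩ := hI.exists_eventually_mu_le hP hf hX hXc hXi hF hN hw hT hr₂
  obtain ⟨K, hK0, δ, hδ, hLip⟩ := hf.exists_ball_norm_natMap_sub_le hX hXc hXi hF hT
  have hz := hI.natMap_eq_zero_of_mapClusterPt hP hf hX hXc hXi hF hN hw hT
  obtain ⟨L, hL0, hL⟩ := hL
  obtain ⟨M, hM0, hM⟩ := hTξ.exists_pos
  obtain ⟨R, hR0, hR⟩ := hrξ.exists_pos
  have hder : ∀ᶠ q : E × ℝ in 𝓝 (wstar.fst - wstar.snd) ×ˢ 𝓝[>] (0 : ℝ),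
      ‖fderiv ℝ (smoothing X f q.2) q.1 - T‖ ≤
        M * (‖q.1 - (wstar.fst - wstar.snd)‖ + |q.2|) ^ (ξ - 1) := by
    filter_upwards [hM.bound] with q hq
    refine hq.trans (mul_le_mul_of_nonneg_left ?_ hM0.le)
    rw [Real.norm_of_nonneg (Real.rpow_nonneg (norm_nonneg _) _)]
    refine Real.rpow_le_rpow (norm_nonneg _) ?_ (by linarith)
    rw [add_comm]
    exact norm_le_norm_snd_add_norm_fst
      (WithLp.toLp 2 (q.1 - (wstar.fst - wstar.snd), q.2))
  have hproj := hf.norm_proj_linearization_le hX hXc hXi hξ hM0.le hder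
  have hzlim : Tendsto (fun k => (I.w k).fst - (I.w k).snd) atTop
      (𝓝 (wstar.fst - wstar.snd)) :=
    (((WithLp.fstL 2 ℝ E E).continuous.sub (WithLp.sndL 2 ℝ E E).continuous).tendsto
      wstar).comp hlim
  have hmulim := hI.tendsto_mu hP hf hX hXc hXi hF hN hw
  refine IsBigO.of_bound
    (C * ((M * 2 ^ ξ + M * (2 + N) ^ (ξ - 1) * 2) + L + R * K ^ ξ)) ?_
  filter_upwards [hacc, hmu, hlim.eventually (Metric.ball_mem_nhds wstar hδ),
    hzlim.eventually hproj, (hzlim.prodMk hmulim).eventually hder, hR.bound]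
    with k hk hmuk hball hpk hdk hrk
  have hμ := hI.mu_pos hP k
  have hD := (hf.hasFDerivAt_natMap_of_ne_zero hX hXc hXi (hF.differentiable (by norm_num))
    hμ.ne' (I.w k)).fderiv
  have h1 := hC k (I.wHat (k + 1) - wstar)
  rw [hI.fderiv_natMap_wHat_sub, hD] at h1
  have h2 := hLip _ hball
  rw [hz, sub_zero] at h2
  set S := fderiv ℝ (smoothing X f (I.mu k)) ((I.w k).fst - (I.w k).snd) with hS
  set G := fderiv ℝ F (I.w k).fst with hG
  set H := natMap X f F 0 (I.w k) with hH
  set ρ := ‖I.w k - wstar‖ with hρ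
  have hρ0 : 0 ≤ ρ := norm_nonneg _
  have hξ0 : 0 ≤ ξ := by linarith
  have hfst : ‖(I.w k).fst - wstar.fst‖ ≤ ρ := norm_fst_le (I.w k - wstar)
  have hsnd : ‖(I.w k).snd - wstar.snd‖ ≤ ρ := norm_snd_le (I.w k - wstar)
  set d := (I.w k).fst - (I.w k).snd - (wstar.fst - wstar.snd) with hd
  have hdρ : ‖d‖ ≤ 2 * ρ := by
    rw [hd, sub_sub_sub_comm, two_mul]
    exact (norm_sub_le _ _).trans (add_le_add hfst hsnd)
  have hρξ : ρ ^ (ξ - 1) * ρ = ρ ^ ξ := by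
    rw [← Real.rpow_add_one' hρ0 (by linarith), sub_add_cancel]
  have hr : ‖I.r₂ k‖ ≤ R * K ^ ξ * ρ ^ ξ := by
    rw [Real.norm_of_nonneg (Real.rpow_nonneg (norm_nonneg _) _)] at hrk
    rw [mul_assoc, ← Real.mul_rpow hK0.le hρ0]
    exact hrk.trans (mul_le_mul_of_nonneg_left
      (Real.rpow_le_rpow (norm_nonneg _) h2 hξ0) hR0.le)
  have hsndcomp : ‖(natMapDeriv S G (I.w k - wstar) - H).snd‖ ≤ L * ρ ^ ξ := by
    have h3 : F wstar.fst - wstar.snd = 0 := by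
      rw [← natMap_snd, hz, WithLp.zero_snd]
    -- Since `F(x*) = y*`, this is the remainder of `F` linearized at the moving point `x_k` and
    -- evaluated at `x*`; hence the need for a bound uniform in the base point.
    have h4 : (natMapDeriv S G (I.w k - wstar) - H).snd =
        F wstar.fst - F (I.w k).fst - G (wstar.fst - (I.w k).fst) := by
      rw [WithLp.sub_snd, natMapDeriv_apply_snd, hH, natMap_snd]
      simp only [WithLp.sub_fst, WithLp.sub_snd, map_sub]
      rw [sub_eq_zero.1 h3]
      abel
    rw [h4]
    refine (hL _ _).trans (mul_le_mul_of_nonneg_left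
      (Real.rpow_le_rpow (norm_nonneg _) ?_ hξ0) hL0.le)
    rwa [norm_sub_rev]
  have hfstcomp : ‖(natMapDeriv S G (I.w k - wstar) - H).fst‖ ≤
      (M * 2 ^ ξ + M * (2 + N) ^ (ξ - 1) * 2) * ρ ^ ξ := by
    have h3 : wstar.fst - smoothing X f 0 (wstar.fst - wstar.snd) = 0 := by
      rw [← natMap_fst (F := F), hz, WithLp.zero_fst]
    -- The projection is linearized by `T` at the fixed point `z*`. Replacing `T` by the actual
    -- derivative `S` costs `(S - T) d`, controlled because `‖d‖ ≤ 2ρ` and `μ_k ≤ Nρ`.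
    have h4 : (natMapDeriv S G (I.w k - wstar) - H).fst =
        (smoothing X f 0 ((I.w k).fst - (I.w k).snd) -
          smoothing X f 0 (wstar.fst - wstar.snd) - T d) - (S - T) d := by
      rw [WithLp.sub_fst, natMapDeriv_apply_fst, hH, natMap_fst]
      simp only [WithLp.sub_fst, WithLp.sub_snd, sub_apply]
      rw [sub_sub_sub_comm (I.w k).fst wstar.fst, ← hd, ← sub_eq_zero.1 h3]
      abel
    have h5 : ‖(S - T) d‖ ≤ M * (2 + N) ^ (ξ - 1) * 2 * ρ ^ ξ := by
      have h6 : ‖S - T‖ ≤ M * ((2 + N) ^ (ξ - 1) * ρ ^ (ξ - 1)) := by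
        refine hdk.trans (mul_le_mul_of_nonneg_left ?_ hM0.le)
        rw [← Real.mul_rpow (by positivity) hρ0]
        refine Real.rpow_le_rpow (by positivity) ?_ (by linarith)
        rw [abs_of_pos hμ, add_mul]
        exact add_le_add hdρ hmuk
      calc ‖(S - T) d‖ ≤ ‖S - T‖ * ‖d‖ := (S - T).le_opNorm d
        _ ≤ M * ((2 + N) ^ (ξ - 1) * ρ ^ (ξ - 1)) * (2 * ρ) :=
          mul_le_mul h6 hdρ (norm_nonneg _) (by positivity)
        _ = M * (2 + N) ^ (ξ - 1) * 2 * ρ ^ ξ := by rw [← hρξ]; ring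
    have h7 : M * ‖d‖ ^ ξ ≤ M * 2 ^ ξ * ρ ^ ξ := by
      rw [mul_assoc, ← Real.mul_rpow zero_le_two hρ0]
      exact mul_le_mul_of_nonneg_left (Real.rpow_le_rpow (norm_nonneg _) hdρ hξ0) hM0.le
    rw [h4, add_mul]
    exact (norm_sub_le _ _).trans (add_le_add (hpk.trans h7) h5)
  rw [(hI.accepted k hk).2.2.2, Real.norm_of_nonneg (Real.rpow_nonneg hρ0 _)]
  refine h1.trans ?_
  rw [mul_assoc]
  refine mul_le_mul_of_nonneg_left ((norm_add_le _ _).trans ?_) hC0.le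
  have := norm_le_norm_snd_add_norm_fst (natMapDeriv S G (I.w k - wstar) - H)
  linarith

end IsInfiniteRun

end Rate

end NonInterior

theorem mainTheorem2 {E : Type*} [NormedAddCommGroup E] [InnerProductSpace ℝ E]
    [FiniteDimensional ℝ E] [CompleteSpace E]
    (X : Set E) (hXclosed : IsClosed X) (hXconvex : Convex ℝ X) (hXint : (interior X).Nonempty)
    (F : E → E) (hF : ContDiff ℝ 1 F)
    (f : E → ℝ) (ϑ : ℝ) (hf : NonInterior.IsSelfConcordantBarrier X f ϑ)
    (P : NonInterior.Params) (hP : P.Valid ϑ)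
    (I : NonInterior.Iterates E) (hI : NonInterior.IsInfiniteRun X f F P I)
    (hnonsing : NonInterior.UniformlyNonsingular X f F I)
    (hlin : NonInterior.LinearizationLittleO F)
    (wstar : WithLp 2 (E × E)) (hwstar : MapClusterPt wstar atTop I.w)
    (T : E →L[ℝ] E)
    (hT : Tendsto (fun q : E × ℝ => fderiv ℝ (NonInterior.smoothing X f q.2) q.1)
      (𝓝 (wstar.fst - wstar.snd) ×ˢ 𝓝[>] (0 : ℝ)) (𝓝 T))
    (hr₂ : I.r₂ =o[atTop] fun k => NonInterior.natMap X f F 0 (I.w k)) :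
    (Tendsto I.w atTop (𝓝 wstar) ∧
      (fun k => I.w (k + 1) - wstar) =o[atTop] (fun k => I.w k - wstar) ∧
      (∀ᶠ k in atTop,
        I.wHat (k + 1) ∈ NonInterior.nbhd X f F P.β (I.muTilde (k + 1)) ∧
        I.w (k + 1) = I.wHat (k + 1))) ∧
    (∀ ξ : ℝ, 1 < ξ → NonInterior.LinearizationOrder F ξ →
      (fun q : E × ℝ => fderiv ℝ (NonInterior.smoothing X f q.2) q.1 - T)
        =O[𝓝 (wstar.fst - wstar.snd) ×ˢ 𝓝[>] (0 : ℝ)]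
        (fun q : E × ℝ =>
          ‖WithLp.toLp 2 (q.1 - (wstar.fst - wstar.snd), q.2)‖ ^ (ξ - 1)) →
      I.r₂ =O[atTop] (fun k => ‖NonInterior.natMap X f F 0 (I.w k)‖ ^ ξ) →
      (fun k => I.w (k + 1) - wstar) =O[atTop] (fun k => ‖I.w k - wstar‖ ^ ξ)) := by
  obtain ⟨hlim, hacc⟩ :=
    hI.tendsto_w hP hf hXconvex hXclosed hXint hF hnonsing hwstar hT hr₂
  refine ⟨⟨hlim, hI.isLittleO_w_succ_sub hP hf hXconvex hXclosed hXint hF hnonsing hwstar hT hr₂,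
    hacc.mono fun k hk => ⟨hk, (hI.accepted k hk).2.2.2⟩⟩, fun ξ hξ hL hTξ hrξ => ?_⟩
  exact hI.isBigO_w_succ_sub hP hf hXconvex hXclosed hXint hF hnonsing hwstar hT hr₂ hξ hL hTξ hrξ
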